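/- Let $n\ge 2$. On $\mathbb R^n$ write $x=r\omega$ with $r=|x|$, $\omega\in\mathbb S^{n-1}$, and let $Y=(Y_1,\dots,Y_{n(n+1)/2})$ be the vector fields $\partial_1,\dots,\partial_n$ followed by the rotations $\Omega_{ij}=x_i\partial_j-x_j\partial_i$, $1\le i<j\le n$ (in lexicographic order). For a multi-index $\mu$ put $Y^\mu=Y_1^{\mu_1}Y_2^{\mu_2}\cdots$ and $|\mu|=\sum_i\mu_i$. For $1\le q,s\le\infty$ let $$\|f\|_{L^q_rL^s_\omega(r\ge R)}=\Bigl(\int_R^\infty \|f(r\,\cdot)\|_{L^s(\mathbb S^{n-1})}^q\,r^{n-1}\,dr\Bigr)^{1/q}\in[0,\infty],$$ with the essential supremum over $r\ge R$ when $q=\infty$; set $1/\infty=0$, and let $[\,\cdot\,]$ be the integer part. (i) Let $\beta\in\mathbb R$, $\varepsilon>0$ and $2+\varepsilon\le p\le q\le\infty$. Then there is a constant $C$, depending only on $n,\beta,\varepsilon,p,q$, such that $$\|r^{\beta}u\|_{L^q_rL^\infty_\omega(r\ge R+1)}\le C\sum_{|\mu|\le[(n+1)/2]}\bigl\|r^{\beta-\frac{n-1}{p}+\frac{n-1}{q}}\,Y^\mu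 u\bigr\|_{L^p_rL^{2+\varepsilon}_\omega(r\ge R)}$$ for every $R\ge 3$ and every (real- or complex-valued) $u$ on $\{|x|>R\}$ that is locally integrable together with its weak derivatives $Y^\mu u$, $|\mu|\le[(n+1)/2]$. (ii) Let $\beta\in\mathbb R$ and $2\le p\le q\le\infty$. Then there is a constant $C$, depending only on $n,\beta,p,q$, such that $$\|r^{\beta}u\|_{L^q_rL^\infty_\omega(r\ge R+1)}\le C\sum_{|\mu|\le[(n+2)/2]}\bigl\|r^{\beta-\frac{n-1}{p}+\frac{n-1}{q}}\,Y^\mu u\bigr\|_{L^p_rL^{2}_\omega(r\ge R)}$$ for every $R\ge 3$ and every $u$ on $\{|x|>R\}$ that is locally integrable together with its weak derivatives $Y^\mu u$, $|\mu|\le[(n+2)/2]$. (iii) Let $\beta\in\mathbb R$ and $2\le p\le q\le 4$. Then there is a constant $C$, depending only on $n,\beta,p,q$, such that $$\|r^{\beta}u\|_{L^q_rL^4_\omega(r\ge R+1)}\le C\sum_{|\mu|\le[(n+3)/4]}\bigl\|r^{\beta-\frac{n-1}{p}+\frac{n-1}{q}}\,Y^\mu u\bigr\|_{L^p_rL^{2}_\omega(r\ge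 R)}$$ for every $R\ge 3$ and every $u$ on $\{|x|>R\}$ that is locally integrable together with its weak derivatives $Y^\mu u$, $|\mu|\le[(n+3)/4]$. -/

import Mathlib

open MeasureTheory Set
open scoped ENNReal NNReal ContDiff

noncomputable section

namespace WeightedSobolev

/-- Labels of the vector fields `Y`: `Sum.inl i` stands for `∂_i`, and
`Sum.inr (i, j)` with `i < j` stands for the rotation `Ω_{ij} = x_i ∂_j - x_j ∂_i`. -/
abbrev YIndex (n : ℕ) : Type := Fin n ⊕ {p : Fin n × Fin n // p.1 < p.2}

/-- The enumeration `Y_1, Y_2, …, Y_{n(n+1)/2}`: first `∂_1, …, ∂_n`, then the `Ω_{ij}`, `i < j`,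
in lexicographic order. -/
def yList (n : ℕ) : List (YIndex n) :=
  (List.finRange n).map Sum.inl ++
    (List.finRange n).flatMap fun i =>
      (List.finRange n).filterMap fun j =>
        if h : i < j then some (Sum.inr ⟨(i, j), h⟩) else none

/-- The value at `x` of the vector field with a given label. -/
def yVec {n : ℕ} (a : YIndex n) (x : EuclideanSpace ℝ (Fin n)) : EuclideanSpace ℝ (Fin n) :=
  match a with
  | Sum.inl i => EuclideanSpace.single i 1
  | Sum.inr p =>
      x p.1.1 • EuclideanSpace.single p.1.2 1 - x p.1.2 • EuclideanSpace.single p.1.1 1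

/-- The (classical) action of a vector field on functions. -/
def yOp {n : ℕ} (a : YIndex n) (f : EuclideanSpace ℝ (Fin n) → ℝ) :
    EuclideanSpace ℝ (Fin n) → ℝ :=
  fun x => fderiv ℝ f x (yVec a x)

/-- Multi-indices, one exponent for each of the fields `Y_1, …, Y_{n(n+1)/2}`. -/
abbrev YMulti (n : ℕ) : Type := YIndex n → ℕ

/-- The length `|μ|` of a multi-index. -/
def yLen {n : ℕ} (μ : YMulti n) : ℕ := ∑ a, μ a

/-- The finite set of all multi-indices with `|μ| ≤ k`. -/
def yMultis (n k : ℕ) : Finset (YMulti n) :=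
  (Fintype.piFinset fun _ : YIndex n => Finset.range (k + 1)).filter fun μ => yLen μ ≤ k

theorem mem_yMultis {n k : ℕ} (μ : YMulti n) : μ ∈ yMultis n k ↔ yLen μ ≤ k := by
  simp only [yMultis, Finset.mem_filter, Fintype.mem_piFinset, Finset.mem_range,
    and_iff_right_iff_imp]
  intro h a
  exact Nat.lt_succ_of_le
    ((Finset.single_le_sum (f := μ) (fun _ _ => Nat.zero_le _) (Finset.mem_univ a)).trans h)

/-- For `Y^μ = Y_1^{μ_1} Y_2^{μ_2} ⋯ Y_N^{μ_N}`, `N = n(n+1)/2`, this is the operator in the opposite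
order, `Y_N^{μ_N} ⋯ Y_2^{μ_2} Y_1^{μ_1}` (so `Y_1^{μ_1}` is applied to `φ` first). As all the fields
are divergence free, `(-1)^{|μ|}` times this operator is the formal adjoint of `Y^μ`. -/
def yRev {n : ℕ} (μ : YMulti n) (φ : EuclideanSpace ℝ (Fin n) → ℝ) :
    EuclideanSpace ℝ (Fin n) → ℝ :=
  (yList n).foldl (fun ψ a => (yOp a)^[μ a] ψ) φ

/-- `v = Y^μ u` on the open set `U` in the weak (distributional) sense, with `u`, `v` locally
integrable on `U`. -/
structure HasWeakY {𝕜 : Type*} [RCLike 𝕜] {n : ℕ} (U : Set (EuclideanSpace ℝ (Fin n)))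
    (μ : YMulti n) (u v : EuclideanSpace ℝ (Fin n) → 𝕜) : Prop where
  locallyIntegrableOn_left : LocallyIntegrableOn u U volume
  locallyIntegrableOn_right : LocallyIntegrableOn v U volume
  integral_eq : ∀ φ : EuclideanSpace ℝ (Fin n) → ℝ,
    ContDiff ℝ ∞ φ → HasCompactSupport φ → tsupport φ ⊆ U →
      ∫ x, yRev μ φ x • u x = (-1 : ℝ) ^ yLen μ • ∫ x, φ x • v x

/-- The measure `r^{n-1} dr` on `[R, ∞)`. -/
def radialMeasure (n : ℕ) (R : ℝ) : Measure ℝ :=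
  (volume.restrict (Ici R)).withDensity fun r => ENNReal.ofReal (r ^ (n - 1))

/-- The mixed norm `‖f‖_{L^q_r L^s_ω (r ≥ R)}`: the norm in `L^q([R, ∞), r^{n-1} dr)` of
`r ↦ ‖f(r ·)‖_{L^s(S^{n-1})}`, where the sphere carries its surface measure; an essential supremum
where the exponent is `∞`. The value lies in `[0, ∞]`. -/
def mixedNorm {𝕜 : Type*} [RCLike 𝕜] {n : ℕ} (q s : ℝ≥0∞) (R : ℝ)
    (f : EuclideanSpace ℝ (Fin n) → 𝕜) : ℝ≥0∞ :=
  eLpNorm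
    (fun r : ℝ =>
      eLpNorm
        (fun θ : Metric.sphere (0 : EuclideanSpace ℝ (Fin n)) 1 =>
          f (r • (θ : EuclideanSpace ℝ (Fin n))))
        s (volume : Measure (EuclideanSpace ℝ (Fin n))).toSphere)
    q (radialMeasure n R)

/-- The function `r^γ f`, `r = |x|`. -/
def rWeight {𝕜 : Type*} [RCLike 𝕜] {n : ℕ} (γ : ℝ) (f : EuclideanSpace ℝ (Fin n) → 𝕜) :
    EuclideanSpace ℝ (Fin n) → 𝕜 :=
  fun x => (‖x‖ ^ γ : ℝ) • f x

/-- The estimate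
`‖r^β u‖_{L^q_r L^a_ω (r ≥ R+1)} ≤ C ∑_{|μ| ≤ k} ‖r^{β-(n-1)/p+(n-1)/q} Y^μ u‖_{L^p_r L^b_ω (r ≥ R)}`
with one constant `C` for all `R ≥ 3` and all `u` whose weak derivatives `Y^μ u`, `|μ| ≤ k`, are
locally integrable functions (called `v μ`) on `|x| > R`. -/
def SobolevEstimate (𝕜 : Type*) [RCLike 𝕜] (n k : ℕ) (β : ℝ) (p q a b : ℝ≥0∞) : Prop :=
  ∃ C : ℝ≥0, ∀ R : ℝ, 3 ≤ R →
    ∀ (u : EuclideanSpace ℝ (Fin n) → 𝕜) (v : YMulti n → EuclideanSpace ℝ (Fin n) → 𝕜),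
      (∀ μ ∈ yMultis n k, HasWeakY {x | R < ‖x‖} μ u (v μ)) →
      mixedNorm q a (R + 1) (rWeight β u) ≤
        C * ∑ μ ∈ yMultis n k,
          mixedNorm p b R
            (rWeight (β - ((n : ℝ) - 1) * (p⁻¹).toReal + ((n : ℝ) - 1) * (q⁻¹).toReal) (v μ))

end WeightedSobolev

end

/-! On unit-width annuli the estimate is a local Sobolev inequality, and everything rests on a
constant that does not depend on the radius. The radial shift `r ω ↦ (r + a) ω` carries the fixed
annulus `3/2 ≤ |y| ≤ 7/2` to `a + 3/2 ≤ |x| ≤ a + 7/2` and preserves the measure `dr dω`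
(`map_radialShift_cylMeasure`). Partial derivatives of a pulled-back function are combinations of
`∂_l f` and `Ω_{jl} f` at the shifted point, with coefficients smooth away from the origin and free
of `a` (`fderiv_radialShift_single`). Hence derivatives of order `k` of the cut-off pull-back are
bounded, uniformly in `a`, by words of length at most `k` in the fields. As the fields span a Lie
algebra, such words reduce to the ordered monomials `Y^μ` with `|μ| ≤ k`
(`genSpan_pow_le_span_yWord`).

Two Sobolev inequalities on a fixed ball are fed into this. When `k s > n`, integration along rays
and Hölder's inequality against the kernel `|z|^{k-n}` give `L^s → L^∞` (`localSobolev_top`).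
Iterating the Gagliardo–Nirenberg–Sobolev inequality gives `L^2 → L^4` (`localSobolev_four`).

Weak derivatives are reached by radial mollification, which commutes with translations and rotations
and so with every `Y^μ` (`yPow_kernelInt_mollKernel`). Lebesgue differentiation and Fatou's lemma
then remove the mollification (`exists_eLpNorm_cyl_le_weak`).

On a radial interval `[b, b + 3)` all powers of `r` are comparable to those of `b`, and the exponent
`β - (n-1)/p + (n-1)/q` is exactly the one for which the powers of `b` on the two sides agree.
Hölder's inequality in `r` adjusts the exponents, using `s ≤ p` and `q ≤ t`. The intervals are
summed with `ℓ^p ⊆ ℓ^q`, which is where `p ≤ q` enters (`eLpNorm_Ici_le_of_intervals`). -/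

noncomputable section

namespace WeightedSobolev

/-! ### Reordering words in an algebra whose generators have commutators in their own span. -/

section Straightening

variable {A ι : Type*} [Ring A] [Algebra ℝ A]

/-- The span of `1` and the generators. -/
def genSpan (y : ι → A) : Submodule ℝ A := Submodule.span ℝ (insert 1 (range y))

theorem one_mem_genSpan (y : ι → A) : (1 : A) ∈ genSpan y :=
  Submodule.subset_span (mem_insert _ _)

theorem gen_mem_genSpan (y : ι → A) (a : ι) : y a ∈ genSpan y :=
  Submodule.subset_span (mem_insert_of_mem _ (mem_range_self a))

theorem genSpan_pow_mono (y : ι → A) {k l : ℕ} (h : k ≤ l) : genSpan y ^ k ≤ genSpan y ^ l :=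
  pow_le_pow_right' (Submodule.one_le.2 (one_mem_genSpan y)) h

theorem map_prod_mem_genSpan_pow (y : ι → A) (w : List ι) :
    (w.map y).prod ∈ genSpan y ^ w.length := by
  induction w with
  | nil => simpa using Submodule.one_le.1 (le_refl (1 : Submodule ℝ A))
  | cons a w ih =>
    rw [List.map_cons, List.prod_cons, List.length_cons, pow_succ']
    exact Submodule.mul_mem_mul (gen_mem_genSpan y a) ih

/-- Transposing two neighbouring letters costs a commutator, which lies in `genSpan y` and replaces
two letters by one. Permuting a word thus produces errors of filtration degree one less than its
length; the bound `w.length ≤ m + 1` states this without subtraction. -/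
theorem map_prod_sub_mem_of_perm {y : ι → A}
    (hy : ∀ a b, y a * y b - y b * y a ∈ genSpan y) {w w' : List ι} (h : w.Perm w') :
    ∀ m : ℕ, w.length ≤ m + 1 → (w.map y).prod - (w'.map y).prod ∈ genSpan y ^ m := by
  induction h with
  | nil => intro m _; simp
  | @cons a w w' h ih =>
    intro m hm
    rcases m with _ | m
    · have : w = [] := by simpa using hm
      subst this
      have : w' = [] := by simpa using h
      subst this
      simp
    · have := ih m (by simpa using hm)
      rw [List.map_cons, List.prod_cons, List.map_cons, List.prod_cons, ← mul_sub, pow_succ']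
      exact Submodule.mul_mem_mul (gen_mem_genSpan y a) this
  | swap a b w =>
    intro m hm
    have e : ((b :: a :: w).map y).prod - ((a :: b :: w).map y).prod
        = (y b * y a - y a * y b) * (w.map y).prod := by
      simp [sub_mul, mul_assoc]
    rw [e]
    have hlen : w.length + 1 ≤ m := by simpa using hm
    apply genSpan_pow_mono y hlen
    rw [pow_succ']
    exact Submodule.mul_mem_mul (hy b a) (map_prod_mem_genSpan_pow y w)
  | @trans w₁ w₂ w₃ h₁ h₂ ih₁ ih₂ =>
    intro m hm
    have := add_mem (ih₁ m hm) (ih₂ m (h₁.length_eq ▸ hm))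
    simpa using this

end Straightening

/-! ### Ordered monomials in the fields `Y`. -/

section Words

variable {n : ℕ}

/-- Counting letters with `List.count` compares labels by `==`, and recovering permutations from
counts needs this to agree with equality. -/
instance : LawfulBEq (YIndex n) where
  eq_of_beq := by
    rintro (a | a) (b | b) h
    · exact congrArg _ (eq_of_beq (α := Fin n) h)
    · cases h
    · cases h
    · exact congrArg _ (Subtype.ext (eq_of_beq (α := Fin n × Fin n) h))
  rfl := by
    rintro (a | a)
    · exact beq_self_eq_true (α := Fin n) a
    · exact beq_self_eq_true (α := Fin n × Fin n) a

theorem mem_yList (a : YIndex n) : a ∈ yList n := by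
  rcases a with i | ⟨⟨i, j⟩, h⟩
  · simp [yList]
  · simp only [yList, List.mem_append, List.mem_map, List.mem_flatMap, List.mem_filterMap]
    right
    exact ⟨i, List.mem_finRange i, j, List.mem_finRange j, by rw [dif_pos h]⟩

theorem nodup_yList : (yList n).Nodup := by
  unfold yList
  refine List.Nodup.append ((List.nodup_finRange n).map Sum.inl_injective) ?_ ?_
  · rw [List.nodup_flatMap]
    refine ⟨fun i _ => (List.nodup_finRange n).filterMap ?_, (List.nodup_finRange n).imp ?_⟩
    · intro j j' b hb hb'
      simp only [Option.mem_def] at hb hb'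
      split_ifs at hb hb' with h h'
      cases hb
      simp only [Option.some.injEq, Sum.inr.injEq, Subtype.mk.injEq, Prod.mk.injEq] at hb'
      exact hb'.2.symm
    · intro i i' hii b hb hb'
      simp only [List.mem_filterMap] at hb hb'
      obtain ⟨j, -, hb⟩ := hb
      obtain ⟨j', -, hb'⟩ := hb'
      split_ifs at hb hb' with h h'
      cases hb
      simp only [Option.some.injEq, Sum.inr.injEq, Subtype.mk.injEq, Prod.mk.injEq] at hb'
      exact hii hb'.1.symm
  · intro b hb hb'
    simp only [List.mem_map, List.mem_flatMap, List.mem_filterMap] at hb hb'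
    obtain ⟨i, -, rfl⟩ := hb
    obtain ⟨i', -, j', -, hb'⟩ := hb'
    split_ifs at hb'
    simp at hb'

/-- The word `Y_1 ⋯ Y_1 Y_2 ⋯ Y_2 ⋯` attached to a multi-index. -/
def yWord (μ : YMulti n) : List (YIndex n) := (yList n).flatMap fun a => List.replicate (μ a) a

theorem count_yWord (μ : YMulti n) (a : YIndex n) : (yWord μ).count a = μ a := by
  have h : ∀ l : List (YIndex n), l.Nodup →
      (l.flatMap fun a => List.replicate (μ a) a).count a = if a ∈ l then μ a else 0 := by
    intro l hl
    induction l with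
    | nil => simp
    | cons b l ih =>
      rw [List.nodup_cons] at hl
      rw [List.flatMap_cons, List.count_append, ih hl.2, List.count_replicate]
      by_cases hab : b = a
      · subst hab; simp [hl.1]
      · have : a ≠ b := fun h => hab h.symm
        simp [hab, this]
  rw [yWord, h _ nodup_yList, if_pos (mem_yList a)]

theorem length_yWord (μ : YMulti n) : (yWord μ).length = yLen μ := by
  have h : (yList n).toFinset = Finset.univ :=
    Finset.eq_univ_iff_forall.2 fun a => List.mem_toFinset.2 (mem_yList a)
  rw [yLen, ← h, List.sum_toFinset _ nodup_yList, yWord, List.length_flatMap]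
  simp

theorem perm_yWord_count (w : List (YIndex n)) : w.Perm (yWord fun a => w.count a) := by
  rw [List.perm_iff_count]
  intro a
  rw [count_yWord]

/-- The spanning half of the Poincaré–Birkhoff–Witt theorem. By induction, put one letter in front
of an ordered monomial and sort: the sorted word is again of the form `yWord`, and the sorting error
has degree at most `k`, so the induction hypothesis covers it. -/
theorem genSpan_pow_le_span_yWord {A : Type*} [Ring A] [Algebra ℝ A] {y : YIndex n → A}
    (hy : ∀ a b, y a * y b - y b * y a ∈ genSpan y) (k : ℕ) :
    genSpan y ^ k ≤
      Submodule.span ℝ ((fun μ : YMulti n => ((yWord μ).map y).prod) '' {μ | yLen μ ≤ k}) := by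
  induction k with
  | zero =>
    rw [pow_zero, Submodule.one_le]
    refine Submodule.subset_span ⟨0, by simp [yLen], ?_⟩
    have : (yWord (0 : YMulti n)) = [] := by
      rw [← List.length_eq_zero_iff, length_yWord]; simp [yLen]
    simp [this]
  | succ k ih =>
    set S : ℕ → Submodule ℝ A := fun k =>
      Submodule.span ℝ ((fun μ : YMulti n => ((yWord μ).map y).prod) '' {μ | yLen μ ≤ k}) with hS
    have hmono : S k ≤ S (k + 1) :=
      Submodule.span_mono (image_mono fun μ (h : yLen μ ≤ k) => le_trans h (Nat.le_succ k))
    rw [pow_succ']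
    refine (mul_le_mul' le_rfl ih).trans ?_
    rw [genSpan, Submodule.span_mul_span, Submodule.span_le]
    rintro _ ⟨z, hz, _, ⟨μ, hμ, rfl⟩, rfl⟩
    rcases hz with rfl | ⟨a, rfl⟩
    · simp only [one_mul]
      exact hmono (Submodule.subset_span ⟨μ, hμ, rfl⟩)
    · have hμ' : yLen μ ≤ k := hμ
      have h := map_prod_sub_mem_of_perm hy (perm_yWord_count (a :: yWord μ)) k
        (by simpa [length_yWord] using hμ')
      have h2 : ((yWord fun b => (a :: yWord μ).count b).map y).prod ∈ S (k + 1) := by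
        refine Submodule.subset_span ⟨_, ?_, rfl⟩
        rw [mem_ofPred_eq, ← length_yWord, ← (perm_yWord_count (a :: yWord μ)).length_eq]
        simpa [length_yWord] using hμ'
      have := add_mem (hmono (ih h)) h2
      simpa using this

end Words

/-! ### Vector fields as derivations of smooth functions. -/

section Fields

variable (V G : Type*) [NormedAddCommGroup V] [NormedSpace ℝ V]
  [NormedAddCommGroup G] [NormedSpace ℝ G]

/-- The real vector space of smooth functions. -/
def smoothFun : Submodule ℝ (V → G) where
  carrier := {f | ContDiff ℝ ∞ f}
  add_mem' {f g} (hf : ContDiff ℝ ∞ f) (hg : ContDiff ℝ ∞ g) := show ContDiff ℝ ∞ (f + g) from hf.add hg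
  zero_mem' := show ContDiff ℝ ∞ (0 : V → G) from contDiff_zero_fun
  smul_mem' c f (hf : ContDiff ℝ ∞ f) := show ContDiff ℝ ∞ (c • f) from contDiff_const.smul hf

variable {V G}

theorem mem_smoothFun {f : V → G} : f ∈ smoothFun V G ↔ ContDiff ℝ ∞ f := Iff.rfl

theorem contDiff_smoothFun (f : smoothFun V G) : ContDiff ℝ ∞ (f : V → G) := mem_smoothFun.1 f.2

theorem differentiable_smoothFun (f : smoothFun V G) : Differentiable ℝ (f : V → G) :=
  (contDiff_smoothFun f).differentiable (by simp)

/-- Differentiation of smooth functions along a smooth vector field. -/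
def derivAlong : smoothFun V V →ₗ[ℝ] Module.End ℝ (smoothFun V G) where
  toFun ξ :=
    { toFun := fun f => ⟨fun x => fderiv ℝ (f : V → G) x ((ξ : V → V) x),
        mem_smoothFun.2 (((contDiff_smoothFun f).fderiv_right (m := ∞) (by simp)).clm_apply (contDiff_smoothFun ξ))⟩
      map_add' := fun f g => by
        ext x
        simp [fderiv_add (differentiable_smoothFun f x) (differentiable_smoothFun g x)]
      map_smul' := fun c f => by
        ext x
        simp [fderiv_const_smul (differentiable_smoothFun f x) c] }
  map_add' ξ ζ := by ext f x; simp
  map_smul' c ξ := by ext f x; simp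

@[simp]
theorem derivAlong_apply (ξ : smoothFun V V) (f : smoothFun V G) (x : V) :
    (derivAlong ξ f : V → G) x = fderiv ℝ (f : V → G) x ((ξ : V → V) x) := rfl

/-- The second-order terms cancel by symmetry of the second derivative, leaving the derivative along
the Lie bracket `η`. -/
theorem derivAlong_commutator (ξ ζ η : smoothFun V V)
    (h : ∀ x, (η : V → V) x = fderiv ℝ (ζ : V → V) x ((ξ : V → V) x)
      - fderiv ℝ (ξ : V → V) x ((ζ : V → V) x)) :
    (derivAlong ξ * derivAlong ζ - derivAlong ζ * derivAlong ξ :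
      Module.End ℝ (smoothFun V G)) = derivAlong η := by
  ext f x
  have hf : Differentiable ℝ (fderiv ℝ (f : V → G)) :=
    ((contDiff_smoothFun f).fderiv_right (m := ∞) (by simp)).differentiable (by simp)
  have key : ∀ ξ ζ : smoothFun V V,
      fderiv ℝ (fun x => fderiv ℝ (f : V → G) x ((ζ : V → V) x)) x ((ξ : V → V) x)
        = fderiv ℝ (fderiv ℝ (f : V → G)) x ((ξ : V → V) x) ((ζ : V → V) x)
          + fderiv ℝ (f : V → G) x (fderiv ℝ (ζ : V → V) x ((ξ : V → V) x)) := by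
    intro ξ ζ
    rw [fderiv_clm_apply (hf x) (differentiable_smoothFun ζ x)]
    simp [add_comm]
  have hsymm : IsSymmSndFDerivAt ℝ (f : V → G) x :=
    (contDiff_smoothFun f).contDiffAt.isSymmSndFDerivAt
      (by simp only [minSmoothness_of_isRCLikeNormedField]; exact WithTop.coe_le_coe.2 (le_top (a := (2 : ℕ∞))))
  change fderiv ℝ (fun x => fderiv ℝ (f : V → G) x ((ζ : V → V) x)) x ((ξ : V → V) x)
    - fderiv ℝ (fun x => fderiv ℝ (f : V → G) x ((ξ : V → V) x)) x ((ζ : V → V) x)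
    = fderiv ℝ (f : V → G) x ((η : V → V) x)
  rw [key, key, h x, map_sub, hsymm ((ξ : V → V) x) ((ζ : V → V) x)]
  abel

end Fields

/-! ### The Lie algebra generated by translations and rotations. -/

section YFields

variable {n : ℕ}

local notation "E" => EuclideanSpace ℝ (Fin n)

theorem contDiff_coord (i : Fin n) : ContDiff ℝ ∞ fun x : E => x i :=
  (EuclideanSpace.proj (𝕜 := ℝ) i).contDiff

/-- The coordinate field `∂_i`. -/
def coordField (i : Fin n) : smoothFun E E :=
  ⟨fun _ => EuclideanSpace.single i 1, mem_smoothFun.2 contDiff_const⟩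

/-- The rotation field `x_i ∂_j - x_j ∂_i`, for any `i`, `j`. -/
def rotField (i j : Fin n) : smoothFun E E :=
  ⟨fun x => x i • EuclideanSpace.single j 1 - x j • EuclideanSpace.single i 1,
    mem_smoothFun.2
      (((contDiff_coord i).smul contDiff_const).sub ((contDiff_coord j).smul contDiff_const))⟩

/-- The fields `Y`, bundled. -/
def yField (a : YIndex n) : smoothFun E E :=
  match a with
  | Sum.inl i => coordField i
  | Sum.inr p => rotField p.1.1 p.1.2

theorem yField_apply (a : YIndex n) (x : E) : (yField a : E → E) x = yVec a x := by
  rcases a with i | p <;> rfl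

theorem coordField_mem_span (i : Fin n) :
    (coordField i : smoothFun E E) ∈ Submodule.span ℝ (range (yField (n := n))) :=
  Submodule.subset_span ⟨Sum.inl i, rfl⟩

theorem rotField_mem_span (i j : Fin n) :
    (rotField i j : smoothFun E E) ∈ Submodule.span ℝ (range (yField (n := n))) := by
  rcases lt_trichotomy i j with h | h | h
  · exact Submodule.subset_span ⟨Sum.inr ⟨(i, j), h⟩, rfl⟩
  · subst h
    have : (rotField i i : smoothFun E E) = 0 := by
      ext x; simp [rotField]
    rw [this]; exact zero_mem _
  · have : (rotField i j : smoothFun E E) = - rotField j i := by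
      ext x; simp [rotField]
    rw [this]
    exact neg_mem (Submodule.subset_span ⟨Sum.inr ⟨(j, i), h⟩, rfl⟩)

theorem fderiv_coordField (i : Fin n) (x v : E) :
    fderiv ℝ (coordField i : E → E) x v = 0 := by
  simp [coordField]

theorem fderiv_rotField (i j : Fin n) (x v : E) :
    fderiv ℝ (rotField i j : E → E) x v = (rotField i j : E → E) v := by
  have h : ∀ i : Fin n, HasFDerivAt (fun x : E => x i) (EuclideanSpace.proj (𝕜 := ℝ) i) x :=
    fun i => (EuclideanSpace.proj (𝕜 := ℝ) i).hasFDerivAt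
  have := ((h i).smul_const (EuclideanSpace.single j (1 : ℝ))).sub
    ((h j).smul_const (EuclideanSpace.single i (1 : ℝ)))
  have e : (rotField i j : E → E) = fun x => x i • EuclideanSpace.single j 1
    - x j • EuclideanSpace.single i 1 := rfl
  rw [e]
  erw [this.fderiv]
  simp

/-- The brackets of the Euclidean Lie algebra: translations commute, a translation and a rotation
give translations, and two rotations give rotations. Rotations with unordered indices appear on the
way and are brought back to `i < j` by antisymmetry. -/
theorem exists_bracket_yField (a b : YIndex n) :
    ∃ η ∈ Submodule.span ℝ (range (yField (n := n))), ∀ x : E,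
      (η : E → E) x = fderiv ℝ (yField b : E → E) x ((yField a : E → E) x)
        - fderiv ℝ (yField a : E → E) x ((yField b : E → E) x) := by
  have hc := coordField_mem_span (n := n)
  have hr := rotField_mem_span (n := n)
  rcases a with i | ⟨⟨i, j⟩, hij⟩ <;> rcases b with k | ⟨⟨k, l⟩, hkl⟩
  · exact ⟨0, zero_mem _, fun x => by simp [yField, fderiv_coordField]⟩
  · refine ⟨(if k = i then (1 : ℝ) else 0) • coordField l - (if l = i then (1 : ℝ) else 0) • coordField k,
      sub_mem (Submodule.smul_mem _ _ (hc l)) (Submodule.smul_mem _ _ (hc k)), fun x => ?_⟩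
    simp only [yField, fderiv_coordField, fderiv_rotField]
    ext m
    simp only [rotField, coordField, Submodule.coe_sub, Submodule.coe_smul, Pi.sub_apply,
      Pi.smul_apply, PiLp.sub_apply, PiLp.smul_apply, PiLp.zero_apply, PiLp.single_apply,
      smul_eq_mul]
    split_ifs <;> simp
  · refine ⟨-((if i = k then (1 : ℝ) else 0) • coordField j - (if j = k then (1 : ℝ) else 0) • coordField i),
      neg_mem (sub_mem (Submodule.smul_mem _ _ (hc j)) (Submodule.smul_mem _ _ (hc i))), fun x => ?_⟩
    simp only [yField, fderiv_coordField, fderiv_rotField]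
    ext m
    simp only [rotField, coordField, Submodule.coe_sub, Submodule.coe_neg, Submodule.coe_smul,
      Pi.sub_apply, Pi.neg_apply, Pi.smul_apply, PiLp.sub_apply, PiLp.neg_apply, PiLp.smul_apply,
      PiLp.zero_apply, PiLp.single_apply, smul_eq_mul]
    split_ifs <;> simp
  · refine ⟨(if j = k then (1 : ℝ) else 0) • rotField i l + (if i = k then (1 : ℝ) else 0) • rotField l j
        + (if j = l then (1 : ℝ) else 0) • rotField k i + (if i = l then (1 : ℝ) else 0) • rotField j k,
      add_mem (add_mem (add_mem (Submodule.smul_mem _ _ (hr _ _)) (Submodule.smul_mem _ _ (hr _ _)))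
        (Submodule.smul_mem _ _ (hr _ _))) (Submodule.smul_mem _ _ (hr _ _)), fun x => ?_⟩
    simp only [yField, fderiv_rotField]
    ext m
    simp only [rotField, Submodule.coe_add, Submodule.coe_smul, Pi.add_apply, Pi.smul_apply,
      PiLp.add_apply, PiLp.smul_apply, PiLp.sub_apply, PiLp.single_apply, smul_eq_mul]
    simp only [@eq_comm _ k j, @eq_comm _ k i, @eq_comm _ l j, @eq_comm _ l i]
    split_ifs <;> ring

variable {G : Type*} [NormedAddCommGroup G] [NormedSpace ℝ G]

variable (G) in
/-- The operators `Y` on smooth functions. -/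
def yEnd (a : YIndex n) : Module.End ℝ (smoothFun E G) := derivAlong (yField a)

theorem derivAlong_mem_genSpan {η : smoothFun E E}
    (h : η ∈ Submodule.span ℝ (range (yField (n := n)))) :
    (derivAlong η : Module.End ℝ (smoothFun E G)) ∈ genSpan (yEnd (n := n) G) := by
  have := Submodule.mem_map_of_mem (f := (derivAlong (V := E) (G := G))) h
  rw [Submodule.map_span] at this
  refine Submodule.span_mono ?_ this
  rintro _ ⟨_, ⟨a, rfl⟩, rfl⟩
  exact mem_insert_of_mem _ ⟨a, rfl⟩

theorem yEnd_commutator_mem (a b : YIndex n) :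
    yEnd G a * yEnd G b - yEnd G b * yEnd G a ∈ genSpan (yEnd (n := n) G) := by
  obtain ⟨η, hη, h⟩ := exists_bracket_yField a b
  rw [yEnd, yEnd, derivAlong_commutator _ _ η h]
  exact derivAlong_mem_genSpan hη

variable (G) in
/-- The operator `Y^μ` on smooth functions. -/
def yPow (μ : YMulti n) : Module.End ℝ (smoothFun E G) := ((yWord μ).map (yEnd G)).prod

theorem exists_norm_le_sum_yPow {k : ℕ} {T : Module.End ℝ (smoothFun E G)}
    (hT : T ∈ genSpan (yEnd (n := n) G) ^ k) :
    ∃ C : ℝ, 0 ≤ C ∧ ∀ (f : smoothFun E G) (x : E),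
      ‖(T f : E → G) x‖ ≤ C * ∑ μ ∈ yMultis n k, ‖(yPow G μ f : E → G) x‖ := by
  have := genSpan_pow_le_span_yWord (yEnd_commutator_mem (n := n) (G := G)) k hT
  induction this using Submodule.span_induction with
  | mem T h =>
    obtain ⟨μ, hμ, rfl⟩ := h
    refine ⟨1, zero_le_one, fun f x => ?_⟩
    rw [one_mul]
    exact Finset.single_le_sum (f := fun μ => ‖(yPow G μ f : E → G) x‖)
      (fun _ _ => norm_nonneg _) ((mem_yMultis μ).2 hμ)
  | zero => exact ⟨0, le_rfl, fun f x => by simp⟩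
  | add S T hS hT' ihS ihT =>
    -- The induction hypotheses still ask for membership in `genSpan ^ k`. It follows from
    -- membership in the span, since each ordered monomial of length at most `k` lies in that power.
    have conv : ∀ {S}, S ∈ Submodule.span ℝ ((fun μ : YMulti n => ((yWord μ).map (yEnd G)).prod) ''
      {μ | yLen μ ≤ k}) → S ∈ genSpan (yEnd (n := n) G) ^ k := by
      intro S hS
      refine (Submodule.span_le.2 ?_) hS
      rintro _ ⟨μ, hμ, rfl⟩
      refine genSpan_pow_mono _ ?_ (map_prod_mem_genSpan_pow _ _)
      rw [length_yWord]; exact hμ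
    obtain ⟨C, hC, h⟩ := ihS (conv hS)
    obtain ⟨C', hC', h'⟩ := ihT (conv hT')
    refine ⟨C + C', add_nonneg hC hC', fun f x => ?_⟩
    rw [add_mul]
    exact (norm_add_le _ _).trans (add_le_add (h f x) (h' f x))
  | smul c T hT' ihT =>
    have conv : T ∈ genSpan (yEnd (n := n) G) ^ k := by
      refine (Submodule.span_le.2 ?_) hT'
      rintro _ ⟨μ, hμ, rfl⟩
      refine genSpan_pow_mono _ ?_ (map_prod_mem_genSpan_pow _ _)
      rw [length_yWord]; exact hμ
    obtain ⟨C, hC, h⟩ := ihT conv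
    refine ⟨‖c‖ * C, by positivity, fun f x => ?_⟩
    have e : ((c • T) f : E → G) x = c • (T f : E → G) x := rfl
    rw [e, norm_smul, mul_assoc]
    exact mul_le_mul_of_nonneg_left (h f x) (norm_nonneg c)

end YFields

/-- Off the closed support the function is locally zero. This makes products of a cutoff with
functions singular at the origin globally smooth. -/
theorem contDiff_of_mem_tsupport {V G : Type*} [NormedAddCommGroup V] [NormedSpace ℝ V]
    [NormedAddCommGroup G] [NormedSpace ℝ G] {m : WithTop ℕ∞} {f : V → G}
    (h : ∀ x ∈ tsupport f, ContDiffAt ℝ m f x) : ContDiff ℝ m f := by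
  refine contDiff_iff_contDiffAt.2 fun x => ?_
  by_cases hx : x ∈ tsupport f
  · exact h x hx
  · exact contDiffAt_const.congr_of_eventuallyEq (notMem_tsupport_iff_eventuallyEq.1 hx)

/-! ### The radial shift and derivative bounds uniform in the shift. -/

section RadialShift

variable {n : ℕ}

local notation "E" => EuclideanSpace ℝ (Fin n)

variable {G : Type*} [NormedAddCommGroup G] [NormedSpace ℝ G]

/-- The map `r ω ↦ (r + a) ω`. -/
def radialShift (a : ℝ) (y : E) : E := (1 + a * ‖y‖⁻¹) • y

theorem radialShift_smul (a : ℝ) {r : ℝ} (hr : 0 < r) {θ : E} (hθ : ‖θ‖ = 1) :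
    radialShift a (r • θ) = (r + a) • θ := by
  rw [radialShift, norm_smul, hθ, smul_smul, Real.norm_of_nonneg hr.le]
  congr 1
  field_simp

theorem contDiffAt_radialShift (a : ℝ) {y : E} (hy : y ≠ 0) :
    ContDiffAt ℝ ∞ (radialShift a : E → E) y :=
  (contDiffAt_const.add (contDiffAt_const.mul ((contDiffAt_norm ℝ hy).inv
    (norm_ne_zero_iff.2 hy)))).smul contDiffAt_id

theorem hasFDerivAt_norm_of_ne_zero {y : E} (hy : y ≠ 0) :
    HasFDerivAt (fun y : E => ‖y‖) (‖y‖⁻¹ • innerSL ℝ y) y := by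
  have h := (hasStrictFDerivAt_norm_sq y).hasFDerivAt.sqrt (by positivity)
  simp only [Real.sqrt_sq (norm_nonneg _)] at h
  have e : (‖y‖⁻¹ • innerSL ℝ y : E →L[ℝ] ℝ) = (1 / (2 * ‖y‖)) • (2 : ℕ) • innerSL ℝ y := by
    rw [← Nat.cast_smul_eq_nsmul ℝ, smul_smul]
    congr 1
    push_cast
    field_simp
  rw [e]
  exact h

theorem fderiv_radialShift (a : ℝ) {y : E} (hy : y ≠ 0) (v : E) :
    fderiv ℝ (radialShift a : E → E) y v
      = (1 + a * ‖y‖⁻¹) • v - (a * (‖y‖⁻¹) ^ 3 * inner ℝ y v) • y := by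
  have hy' : ‖y‖ ≠ 0 := norm_ne_zero_iff.2 hy
  have h := ((((hasDerivAt_inv hy').comp_hasFDerivAt y
    (hasFDerivAt_norm_of_ne_zero hy)).const_mul a).const_add 1).smul (hasFDerivAt_id y)
  have e : fderiv ℝ (radialShift a : E → E) y = _ := h.fderiv
  rw [e]
  simp only [Function.comp_apply, id_eq, _root_.add_apply,
    _root_.smul_apply, ContinuousLinearMap.smulRight_apply,
    ContinuousLinearMap.id_apply, innerSL_apply_apply, smul_eq_mul]
  rw [sub_eq_add_neg, ← neg_smul]
  congr 2
  field_simp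

/-- Split `e_i` into its radial part `(y_i / |y|²) y` and the tangential part `∑_j (y_j / |y|²)
Ω_{ji}(y)`. The differential of the shift fixes `y` and multiplies tangential vectors by `1 + a /
|y|`, which turns `Ω_{ji}(y)` into `Ω_{ji}` at the shifted point. So the coefficients do not involve
`a`. -/
theorem fderiv_radialShift_single (a : ℝ) {y : E} (hy : y ≠ 0) (i : Fin n) :
    fderiv ℝ (radialShift a : E → E) y (EuclideanSpace.single i 1)
      = ∑ l, (y i * y l * (‖y‖ ^ 2)⁻¹) • (coordField l : E → E) (radialShift a y)
        + ∑ j, (y j * (‖y‖ ^ 2)⁻¹) • (rotField j i : E → E) (radialShift a y) := by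
  have hy' : ‖y‖ ≠ 0 := norm_ne_zero_iff.2 hy
  have hs : ∑ j, y j * y j = ‖y‖ ^ 2 := by
    rw [EuclideanSpace.real_norm_sq_eq]; simp [pow_two]
  rw [fderiv_radialShift a hy]
  ext m
  simp only [coordField, rotField, radialShift, PiLp.add_apply, PiLp.sub_apply, PiLp.smul_apply,
    PiLp.single_apply, WithLp.ofLp_sum, Finset.sum_apply, smul_eq_mul,
    EuclideanSpace.inner_single_right]
  have e : ∀ j, y j * (‖y‖ ^ 2)⁻¹ * ((1 + a * ‖y‖⁻¹) * y j * (if m = i then 1 else 0)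
      - (1 + a * ‖y‖⁻¹) * y i * (if m = j then 1 else 0))
      = (y j * y j) * ((‖y‖ ^ 2)⁻¹ * (1 + a * ‖y‖⁻¹) * (if m = i then 1 else 0))
        - (‖y‖ ^ 2)⁻¹ * (1 + a * ‖y‖⁻¹) * y i * (y j * (if m = j then 1 else 0)) := by
    intro j; ring
  simp only [e, Finset.sum_sub_distrib, ← Finset.sum_mul, ← Finset.mul_sum, hs]
  simp
  field_simp
  ring

/-- The index set of all coordinate and rotation fields. -/
abbrev ZIndex (n : ℕ) : Type := Fin n ⊕ (Fin n × Fin n)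

/-- All coordinate and rotation fields, without ordering of the indices. -/
def zField (b : ZIndex n) : smoothFun E E :=
  match b with
  | Sum.inl l => coordField l
  | Sum.inr p => rotField p.1 p.2

variable (G) in
/-- Derivatives along the fields `zField`. -/
def zEnd (b : ZIndex n) : Module.End ℝ (smoothFun E G) := derivAlong (zField b)

theorem zEnd_mem_genSpan (b : ZIndex n) : zEnd G b ∈ genSpan (yEnd (n := n) G) := by
  rcases b with l | p
  · exact derivAlong_mem_genSpan (coordField_mem_span l)
  · exact derivAlong_mem_genSpan (rotField_mem_span p.1 p.2)

/-- The coefficients in `∂_i (f ∘ radialShift a) = ∑ b, c_{ib} (Z_b f) ∘ radialShift a`. -/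
def shiftCoef (i : Fin n) (b : ZIndex n) (y : E) : ℝ :=
  match b with
  | Sum.inl l => y i * y l * (‖y‖ ^ 2)⁻¹
  | Sum.inr p => if p.2 = i then y p.1 * (‖y‖ ^ 2)⁻¹ else 0

theorem contDiffAt_shiftCoef (i : Fin n) (b : ZIndex n) {y : E} (hy : y ≠ 0) :
    ContDiffAt ℝ ∞ (shiftCoef i b) y := by
  have h : ContDiffAt ℝ ∞ (fun y : E => (‖y‖ ^ 2)⁻¹) y :=
    (contDiff_norm_sq ℝ).contDiffAt.inv (by positivity)
  rcases b with l | p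
  · exact ((contDiff_coord i).contDiffAt.mul (contDiff_coord l).contDiffAt).mul h
  · by_cases hp : p.2 = i
    · have e : (shiftCoef i (Sum.inr p) : E → ℝ) = fun y => y p.1 * (‖y‖ ^ 2)⁻¹ := by
        funext y; exact if_pos hp
      rw [e]
      exact (contDiff_coord p.1).contDiffAt.mul h
    · have e : (shiftCoef i (Sum.inr p) : E → ℝ) = fun _ => 0 := by
        funext y; exact if_neg hp
      rw [e]
      exact contDiffAt_const

theorem fderiv_comp_radialShift (a : ℝ) (f : smoothFun E G) {y : E} (hy : y ≠ 0) (i : Fin n) :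
    fderiv ℝ (fun y => (f : E → G) (radialShift a y)) y (EuclideanSpace.single i 1)
      = ∑ b, shiftCoef i b y • (zEnd G b f : E → G) (radialShift a y) := by
  have h : fderiv ℝ (fun y => (f : E → G) (radialShift a y)) y = _ :=
    fderiv_comp y (differentiable_smoothFun f _)
      ((contDiffAt_radialShift a hy).differentiableAt (by simp))
  rw [h, ContinuousLinearMap.comp_apply, fderiv_radialShift_single a hy, map_add, map_sum, map_sum,
    Fintype.sum_sum_type, Fintype.sum_prod_type]
  congr 1
  · simp [shiftCoef, zEnd, zField]
  · refine Finset.sum_congr rfl fun j _ => ?_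
    simp [shiftCoef, zEnd, zField]

/-- The sum of `|Z_{b_1} ⋯ Z_{b_l} f|` over words of length at most `j` (with multiplicities). -/
def iterSum : ℕ → smoothFun E G → E → ℝ
  | 0, f, x => ‖(f : E → G) x‖
  | j + 1, f, x => iterSum j f x + ∑ b, iterSum j (zEnd G b f) x

theorem iterSum_nonneg (j : ℕ) (f : smoothFun E G) (x : E) : 0 ≤ iterSum j f x := by
  induction j generalizing f with
  | zero => exact norm_nonneg _
  | succ j ih => exact add_nonneg (ih f) (Finset.sum_nonneg fun b _ => ih _)

/-- The recursion of `iterSum` applies one more field to `T f`, that is, replaces `T` by `Z_b T` of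
degree one higher. Carrying `T` and its degree `i` lets the induction on `j` absorb these letters
until only the pointwise bound is left. -/
theorem exists_iterSum_le (j i : ℕ) {T : Module.End ℝ (smoothFun E G)}
    (hT : T ∈ genSpan (yEnd (n := n) G) ^ i) :
    ∃ C : ℝ, 0 ≤ C ∧ ∀ (f : smoothFun E G) (x : E),
      iterSum j (T f) x ≤ C * ∑ μ ∈ yMultis n (i + j), ‖(yPow G μ f : E → G) x‖ := by
  induction j generalizing i T with
  | zero => exact exists_norm_le_sum_yPow hT
  | succ j ih =>
    obtain ⟨C, hC, h⟩ := ih (i + 1) (genSpan_pow_mono _ (Nat.le_succ i) hT)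
    have hz : ∀ b : ZIndex n, zEnd G b * T ∈ genSpan (yEnd (n := n) G) ^ (i + 1) := fun b => by
      rw [pow_succ']
      exact Submodule.mul_mem_mul (zEnd_mem_genSpan b) hT
    choose D hD hDf using fun b => ih (i + 1) (hz b)
    refine ⟨C + ∑ b, D b, add_nonneg hC (Finset.sum_nonneg fun b _ => hD b), fun f x => ?_⟩
    have e : i + (j + 1) = i + 1 + j := by omega
    rw [add_mul, Finset.sum_mul, e]
    exact add_le_add (h f x) (Finset.sum_le_sum fun b _ => hDf b f x)

/-- The Fréchet derivative is the sum of the partial derivatives composed with fixed linear maps.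
This reduces a derivative of order `j + 1` to one of order `j` of the partial derivatives, as the
induction below requires. -/
theorem exists_norm_iteratedFDeriv_succ_le (n : ℕ) (G : Type*) [NormedAddCommGroup G]
    [NormedSpace ℝ G] :
    ∃ C : ℝ, 0 ≤ C ∧ ∀ (j : ℕ) (g : EuclideanSpace ℝ (Fin n) → G), ContDiff ℝ ∞ g →
      ∀ y, ‖iteratedFDeriv ℝ (j + 1) g y‖ ≤ C * ∑ i, ‖iteratedFDeriv ℝ j
        (fun x => fderiv ℝ g x (EuclideanSpace.single i 1)) y‖ := by
  set L : Fin n → (G →L[ℝ] (EuclideanSpace ℝ (Fin n) →L[ℝ] G)) := fun i =>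
    ContinuousLinearMap.smulRightL ℝ _ G (EuclideanSpace.proj (𝕜 := ℝ) i) with hL
  refine ⟨∑ i, ‖L i‖, Finset.sum_nonneg fun i _ => norm_nonneg (L i), fun j g hg y => ?_⟩
  have hd : ∀ i, ContDiff ℝ ∞ (fun x => fderiv ℝ g x (EuclideanSpace.single i 1)) := fun i =>
    (hg.fderiv_right (m := ∞) (by simp)).clm_apply contDiff_const
  have e : fderiv ℝ g = fun x => ∑ i, L i (fderiv ℝ g x (EuclideanSpace.single i 1)) := by
    ext x v
    conv_lhs => rw [← (EuclideanSpace.basisFun (Fin n) ℝ).sum_repr v]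
    simp [hL]
  rw [← norm_iteratedFDeriv_fderiv]
  conv_lhs => rw [e]
  rw [iteratedFDeriv_fun_sum_apply]
  · rw [Finset.mul_sum]
    refine (norm_sum_le _ _).trans (Finset.sum_le_sum fun i _ => ?_)
    refine ((L i).norm_iteratedFDeriv_comp_left (hd i).contDiffAt
      (WithTop.coe_le_coe.2 le_top)).trans ?_
    exact mul_le_mul_of_nonneg_right
      (Finset.single_le_sum (f := fun i => ‖L i‖) (fun i _ => norm_nonneg (L i)) (Finset.mem_univ i))
      (norm_nonneg (iteratedFDeriv ℝ j (fun x => fderiv ℝ g x (EuclideanSpace.single i 1)) y))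
  · exact fun i _ => ((L i).contDiff.comp (hd i)).contDiffAt.of_le (WithTop.coe_le_coe.2 le_top)

theorem contDiff_smul_comp_radialShift {χ : E → ℝ} (hχ : ContDiff ℝ ∞ χ)
    (h0 : (0 : E) ∉ tsupport χ) (a : ℝ) (f : smoothFun E G) :
    ContDiff ℝ ∞ fun y => χ y • (f : E → G) (radialShift a y) := by
  refine contDiff_of_mem_tsupport fun y hy => ?_
  have hy0 : y ≠ 0 := by
    rintro rfl
    exact h0 (tsupport_smul_subset_left χ _ hy)
  exact hχ.contDiffAt.smul
    ((contDiff_smoothFun f).contDiffAt.comp y (contDiffAt_radialShift a hy0))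

/-- A partial derivative of `χ · (f ∘ shift)` is a sum of terms of the same shape, with cutoffs `∂_i
χ` and `χ · shiftCoef i b`, supported in the support of `χ` and independent of `a`. The induction
therefore runs over all cutoffs at once. -/
theorem exists_norm_iteratedFDeriv_shift_le (j : ℕ) {χ : E → ℝ} (hχ : ContDiff ℝ ∞ χ)
    (hc : HasCompactSupport χ) (h0 : (0 : E) ∉ tsupport χ) :
    ∃ C : ℝ, 0 ≤ C ∧ ∀ (a : ℝ) (f : smoothFun E G) (y : E),
      ‖iteratedFDeriv ℝ j (fun y => χ y • (f : E → G) (radialShift a y)) y‖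
        ≤ C * iterSum j f (radialShift a y) := by
  induction j generalizing χ with
  | zero =>
    obtain ⟨C, hC⟩ := hχ.continuous.bounded_above_of_compact_support hc
    refine ⟨C, (norm_nonneg _).trans (hC 0), fun a f y => ?_⟩
    rw [norm_iteratedFDeriv_zero, norm_smul]
    exact mul_le_mul_of_nonneg_right (hC y) (norm_nonneg _)
  | succ j ih =>
    obtain ⟨D, hD, hDg⟩ := exists_norm_iteratedFDeriv_succ_le n G
    have hχi : ∀ i, ContDiff ℝ ∞ (fun y => fderiv ℝ χ y (EuclideanSpace.single i 1)) := fun i =>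
      (hχ.fderiv_right (m := ∞) (by simp)).clm_apply contDiff_const
    have hsi : ∀ i, tsupport (fun y => fderiv ℝ χ y (EuclideanSpace.single i (1 : ℝ)))
        ⊆ tsupport χ := fun i => tsupport_fderiv_apply_subset ℝ _
    choose A hA hAf using fun i => ih (hχi i) (hc.mono' ((subset_tsupport _).trans (hsi i)))
      (fun h => h0 (hsi i h))
    have hsb : ∀ i b, tsupport (fun y => χ y * shiftCoef i b y) ⊆ tsupport χ := fun i b =>
      tsupport_mul_subset_left
    have hχb : ∀ i b, ContDiff ℝ ∞ (fun y => χ y * shiftCoef i b y) := fun i b =>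
      contDiff_of_mem_tsupport fun y hy => hχ.contDiffAt.mul (contDiffAt_shiftCoef i b (by
        rintro rfl
        exact h0 (hsb i b hy)))
    choose B hB hBf using fun i b => ih (hχb i b)
      (hc.mono' ((subset_tsupport _).trans (hsb i b))) (fun h => h0 (hsb i b h))
    refine ⟨D * ∑ i, (A i + ∑ b, B i b), mul_nonneg hD (Finset.sum_nonneg fun i _ =>
      add_nonneg (hA i) (Finset.sum_nonneg fun b _ => hB i b)), fun a f y => ?_⟩
    refine (hDg j _ (contDiff_smul_comp_radialShift hχ h0 a f) y).trans ?_
    rw [mul_assoc]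
    refine mul_le_mul_of_nonneg_left ?_ hD
    rw [Finset.sum_mul]
    refine Finset.sum_le_sum fun i _ => ?_
    have e : (fun x => fderiv ℝ (fun y => χ y • (f : E → G) (radialShift a y)) x
        (EuclideanSpace.single i 1))
        = fun y => fderiv ℝ χ y (EuclideanSpace.single i 1) • (f : E → G) (radialShift a y)
          + ∑ b, (χ y * shiftCoef i b y) • (zEnd G b f : E → G) (radialShift a y) := by
      funext y
      -- The chain rule is available only away from the origin. Off the support of `χ`, which may
      -- include the origin, every term vanishes.
      by_cases hy : y ∈ tsupport χ
      · have hy0 : y ≠ 0 := by rintro rfl; exact h0 hy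
        have hd : DifferentiableAt ℝ (fun y => (f : E → G) (radialShift a y)) y :=
          (differentiable_smoothFun f _).comp y
            ((contDiffAt_radialShift a hy0).differentiableAt (by simp))
        rw [fderiv_fun_smul (hχ.differentiable (by simp) y) hd]
        simp only [_root_.add_apply, _root_.smul_apply,
          ContinuousLinearMap.smulRight_apply, fderiv_comp_radialShift a f hy0 i, Finset.smul_sum,
          smul_smul]
        rw [add_comm]
      · have h1 : χ y = 0 := image_eq_zero_of_notMem_tsupport hy
        have h2 : fderiv ℝ χ y (EuclideanSpace.single i (1 : ℝ)) = 0 :=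
          image_eq_zero_of_notMem_tsupport
            (f := fun y => fderiv ℝ χ y (EuclideanSpace.single i (1 : ℝ))) fun h => hy (hsi i h)
        have h3 : fderiv ℝ (fun y => χ y • (f : E → G) (radialShift a y)) y
            (EuclideanSpace.single i 1) = 0 :=
          image_eq_zero_of_notMem_tsupport
            (f := fun y => fderiv ℝ (fun y => χ y • (f : E → G) (radialShift a y)) y
              (EuclideanSpace.single i (1 : ℝ)))
            fun h => hy (tsupport_smul_subset_left χ _ (tsupport_fderiv_apply_subset ℝ _ h))
        rw [h1, h2, h3]
        simp
    have s1 := (contDiff_smul_comp_radialShift (hχi i) (fun h => h0 (hsi i h)) a f)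
    have s2 := fun b => (contDiff_smul_comp_radialShift (hχb i b) (fun h => h0 (hsb i b h)) a
      (zEnd G b f))
    have hj : (j : WithTop ℕ∞) ≤ ((⊤ : ℕ∞) : WithTop ℕ∞) := WithTop.coe_le_coe.2 le_top
    rw [e, fun_iteratedFDeriv_add_apply (s1.contDiffAt.of_le hj)
      ((ContDiff.sum fun b _ => s2 b).contDiffAt.of_le hj),
      iteratedFDeriv_fun_sum_apply fun b _ => (s2 b).contDiffAt.of_le hj]
    refine (norm_add_le _ _).trans ?_
    rw [add_mul]
    have hnn : ∀ b, 0 ≤ iterSum j (zEnd G b f) (radialShift a y) := fun b => iterSum_nonneg _ _ _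
    have hnf : 0 ≤ iterSum j f (radialShift a y) := iterSum_nonneg _ _ _
    refine add_le_add ((hAf i a f y).trans ?_) ((norm_sum_le _ _).trans ?_)
    · refine mul_le_mul_of_nonneg_left ?_ (hA i)
      exact le_add_of_nonneg_right (Finset.sum_nonneg fun b _ => hnn b)
    · rw [Finset.sum_mul]
      refine Finset.sum_le_sum fun b _ => (hBf i b a _ y).trans ?_
      refine mul_le_mul_of_nonneg_left ?_ (hB i b)
      exact (Finset.single_le_sum (f := fun b => iterSum j (zEnd G b f) (radialShift a y))
        (fun b _ => hnn b) (Finset.mem_univ b)).trans (le_add_of_nonneg_left hnf)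

/-- Derivatives of the cut off, radially shifted function are controlled by the fields `Y`,
uniformly in the shift. -/
theorem exists_norm_iteratedFDeriv_shift_le_sum (k : ℕ) {χ : E → ℝ} (hχ : ContDiff ℝ ∞ χ)
    (hc : HasCompactSupport χ) (h0 : (0 : E) ∉ tsupport χ) :
    ∃ C : ℝ, 0 ≤ C ∧ ∀ (a : ℝ) (f : smoothFun E G) (y : E),
      ‖iteratedFDeriv ℝ k (fun y => χ y • (f : E → G) (radialShift a y)) y‖
        ≤ C * ∑ μ ∈ yMultis n k, ‖(yPow G μ f : E → G) (radialShift a y)‖ := by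
  obtain ⟨C, hC, h⟩ := exists_norm_iteratedFDeriv_shift_le (G := G) k hχ hc h0
  obtain ⟨D, hD, h'⟩ := exists_iterSum_le (n := n) (G := G) k 0 (T := 1) (by
    rw [pow_zero]; exact Submodule.one_le.1 le_rfl)
  refine ⟨C * D, mul_nonneg hC hD, fun a f y => (h a f y).trans ?_⟩
  rw [mul_assoc]
  refine mul_le_mul_of_nonneg_left ?_ hC
  have := h' f (radialShift a y)
  rwa [zero_add] at this

end RadialShift

theorem contDiff_iteratedFDeriv_infty {V G : Type*} [NormedAddCommGroup V] [NormedSpace ℝ V]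
    [NormedAddCommGroup G] [NormedSpace ℝ G] {g : V → G} (hg : ContDiff ℝ ∞ g) (k : ℕ) :
    ContDiff ℝ ∞ (iteratedFDeriv ℝ k g) :=
  hg.iteratedFDeriv_right (m := ((⊤ : ℕ∞) : WithTop ℕ∞))
    (show (((⊤ : ℕ∞) + (k : ℕ∞) : ℕ∞) : WithTop ℕ∞) ≤ _ from WithTop.coe_le_coe.2 le_top)

/-! ### Integration in polar coordinates. -/

section Polar

variable {n : ℕ}

local notation "E" => EuclideanSpace ℝ (Fin n)
local notation "S" => Metric.sphere (0 : EuclideanSpace ℝ (Fin n)) 1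
local notation "σ" => Measure.toSphere (volume : Measure (EuclideanSpace ℝ (Fin n)))

theorem lintegral_polar (hn : 0 < n) {F : E → ℝ≥0∞} (hF : Measurable F) :
    ∫⁻ x, F x = ∫⁻ θ : S,
      (∫⁻ r in Ioi (0 : ℝ), ENNReal.ofReal (r ^ (n - 1)) * F (r • (θ : E))) ∂σ := by
  have : Nontrivial E := by
    have : Nonempty (Fin n) := ⟨⟨0, hn⟩⟩
    infer_instance
  have hmp := (volume : Measure E).measurePreserving_homeomorphUnitSphereProd
  have hG : Measurable fun p : S × Ioi (0 : ℝ) => F ((p.2 : ℝ) • (p.1 : E)) := by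
    apply hF.comp
    fun_prop
  calc ∫⁻ x, F x = ∫⁻ x in ({0}ᶜ : Set E), F x := by rw [restrict_compl_singleton]
    _ = ∫⁻ x : ({0}ᶜ : Set E), F x ∂(volume.comap Subtype.val) :=
        (lintegral_subtype_comap (measurableSet_singleton _).compl _).symm
    _ = ∫⁻ x : ({0}ᶜ : Set E), F (((homeomorphUnitSphereProd E x).2 : ℝ) •
          ((homeomorphUnitSphereProd E x).1 : E)) ∂(volume.comap Subtype.val) := by
        refine lintegral_congr fun x => ?_
        rw [← homeomorphUnitSphereProd_symm_apply_coe, Homeomorph.symm_apply_apply]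
    _ = ∫⁻ p, F ((p.2 : ℝ) • (p.1 : E)) ∂((σ).prod
          (Measure.volumeIoiPow (Module.finrank ℝ E - 1))) :=
        hmp.lintegral_comp hG
    _ = ∫⁻ θ : S, ∫⁻ r : Ioi (0 : ℝ), F ((r : ℝ) • (θ : E))
          ∂(Measure.volumeIoiPow (Module.finrank ℝ E - 1)) ∂σ :=
        lintegral_prod _ hG.aemeasurable
    _ = _ := by
        refine lintegral_congr fun θ => ?_
        have h1 : Measurable fun r : Ioi (0 : ℝ) => ENNReal.ofReal ((r : ℝ) ^ (n - 1)) := by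
          fun_prop
        have h2 : Measurable fun r : Ioi (0 : ℝ) => F ((r : ℝ) • (θ : E)) := by
          apply hF.comp; fun_prop
        rw [finrank_euclideanSpace_fin, Measure.volumeIoiPow,
          lintegral_withDensity_eq_lintegral_mul _ h1 h2]
        exact lintegral_subtype_comap measurableSet_Ioi
          fun r : ℝ => ENNReal.ofReal (r ^ (n - 1)) * F (r • (θ : E))

end Polar

/-! ### Pointwise bounds by integrating derivatives along rays. -/

section Potential

variable {n : ℕ}

local notation "E" => EuclideanSpace ℝ (Fin n)

variable {G : Type*} [NormedAddCommGroup G] [NormedSpace ℝ G]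

/-- The fundamental theorem of calculus from infinity, where `g` vanishes. The ray is run backwards,
as `y - τ θ`, because the one-dimensional inequality applied integrates over a half line ending at
the point. -/
theorem enorm_iteratedFDeriv_le_lintegral_ray {g : E → G} (hg : ContDiff ℝ ∞ g)
    (hc : HasCompactSupport g) (k : ℕ) (y : E) {θ : E} (hθ : ‖θ‖ = 1) (t₀ : ℝ) :
    ‖iteratedFDeriv ℝ k g (y + t₀ • θ)‖ₑ
      ≤ ∫⁻ t in Ici t₀, ‖iteratedFDeriv ℝ (k + 1) g (y + t • θ)‖ₑ := by
  have hF : ContDiff ℝ ∞ (iteratedFDeriv ℝ k g) := contDiff_iteratedFDeriv_infty hg _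
  have hline : ∀ τ : ℝ, HasDerivAt (fun τ : ℝ => y - τ • θ) (-θ) τ := fun τ => by
    simpa using ((hasDerivAt_id τ).smul_const θ).const_sub y
  have hcont : ContDiff ℝ 1 (fun τ : ℝ => iteratedFDeriv ℝ k g (y - τ • θ)) :=
    (hF.of_le (by simp)).comp (contDiff_const.sub (contDiff_id.smul contDiff_const))
  have hemb : Topology.IsClosedEmbedding (fun τ : ℝ => y - τ • θ) := by
    refine Isometry.isClosedEmbedding (Isometry.of_dist_eq fun a b => ?_)
    rw [dist_sub_left, dist_eq_norm, ← sub_smul, norm_smul, hθ, mul_one, dist_eq_norm]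
  have hcs : HasCompactSupport (fun τ : ℝ => iteratedFDeriv ℝ k g (y - τ • θ)) :=
    (hc.iteratedFDeriv k).comp_isClosedEmbedding hemb
  have h := HasCompactSupport.enorm_le_lintegral_Ici_deriv hcont hcs (-t₀)
  simp only [neg_smul, sub_neg_eq_add] at h
  refine h.trans ?_
  have hd : ∀ τ : ℝ, ‖deriv (fun τ : ℝ => iteratedFDeriv ℝ k g (y - τ • θ)) τ‖ₑ
      ≤ ‖iteratedFDeriv ℝ (k + 1) g (y + (-τ) • θ)‖ₑ := fun τ => by
    have h1 := ((hF.differentiable (by simp)) (y - τ • θ)).hasFDerivAt.comp_hasDerivAt τ (hline τ)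
    have h2 : deriv (fun τ : ℝ => iteratedFDeriv ℝ k g (y - τ • θ)) τ = _ := h1.deriv
    rw [h2, neg_smul, ← sub_eq_add_neg, ← ofReal_norm, ← ofReal_norm]
    apply ENNReal.ofReal_le_ofReal
    refine (ContinuousLinearMap.le_opNorm _ _).trans ?_
    rw [norm_fderiv_iteratedFDeriv, norm_neg, hθ, mul_one]
  refine (lintegral_mono hd).trans (le_of_eq ?_)
  have := (Measure.measurePreserving_neg (volume : Measure ℝ)).setLIntegral_comp_preimage_emb
    (MeasurableEquiv.neg ℝ).measurableEmbedding
    (fun t => ‖iteratedFDeriv ℝ (k + 1) g (y + t • θ)‖ₑ) (Ici t₀)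
  rw [← this]
  simp

/-- Iterate the one-step bound: Tonelli exchanges the two radial integrals, and `∫_0^s t^k dt` is
bounded crudely by `s^(k+1)`, as only the power matters. -/
theorem enorm_le_lintegral_ray {g : E → G} (hg : ContDiff ℝ ∞ g)
    (hc : HasCompactSupport g) (k : ℕ) (y : E) {θ : E} (hθ : ‖θ‖ = 1) :
    ‖g y‖ₑ ≤ ∫⁻ t in Ioi (0 : ℝ), ENNReal.ofReal (t ^ k) *
      ‖iteratedFDeriv ℝ (k + 1) g (y + t • θ)‖ₑ := by
  have hm : ∀ k, Measurable fun t : ℝ => ‖iteratedFDeriv ℝ k g (y + t • θ)‖ₑ := fun k =>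
    (((hg.continuous_iteratedFDeriv (m := k) (WithTop.coe_le_coe.2 le_top)).comp
      (by fun_prop : Continuous fun t : ℝ => y + t • θ)).enorm).measurable
  induction k with
  | zero =>
    have h := enorm_iteratedFDeriv_le_lintegral_ray hg hc 0 y hθ 0
    rw [enorm_eq_iff_norm_eq.2 (norm_iteratedFDeriv_zero (𝕜 := ℝ))] at h
    rw [setLIntegral_congr Ioi_ae_eq_Ici]
    simpa using h
  | succ k ih =>
    refine ih.trans ?_
    calc ∫⁻ t in Ioi (0 : ℝ), ENNReal.ofReal (t ^ k) * ‖iteratedFDeriv ℝ (k + 1) g (y + t • θ)‖ₑ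
        ≤ ∫⁻ t in Ioi (0 : ℝ), ENNReal.ofReal (t ^ k) *
            ∫⁻ s in Ioi (0 : ℝ), (Ici t).indicator
              (fun s => ‖iteratedFDeriv ℝ (k + 1 + 1) g (y + s • θ)‖ₑ) s := by
          refine setLIntegral_mono' measurableSet_Ioi fun t ht => ?_
          gcongr
          refine (enorm_iteratedFDeriv_le_lintegral_ray hg hc (k + 1) y hθ t).trans (le_of_eq ?_)
          rw [setLIntegral_indicator measurableSet_Ici, inter_eq_left.2]
          exact fun s (hs : t ≤ s) => lt_of_lt_of_le ht hs
      _ = ∫⁻ t in Ioi (0 : ℝ), ∫⁻ s in Ioi (0 : ℝ), ENNReal.ofReal (t ^ k) * (Ici t).indicator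
              (fun s => ‖iteratedFDeriv ℝ (k + 1 + 1) g (y + s • θ)‖ₑ) s := by
          refine lintegral_congr fun t => ?_
          rw [lintegral_const_mul _ ((hm _).indicator measurableSet_Ici)]
      _ = ∫⁻ s in Ioi (0 : ℝ), ∫⁻ t in Ioi (0 : ℝ), ENNReal.ofReal (t ^ k) * (Ici t).indicator
              (fun s => ‖iteratedFDeriv ℝ (k + 1 + 1) g (y + s • θ)‖ₑ) s := by
          refine lintegral_lintegral_swap (Measurable.aemeasurable ?_)
          refine (by fun_prop : Measurable fun p : ℝ × ℝ => ENNReal.ofReal (p.1 ^ k)).mul ?_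
          have : (fun p : ℝ × ℝ => (Ici p.1).indicator
              (fun s => ‖iteratedFDeriv ℝ (k + 1 + 1) g (y + s • θ)‖ₑ) p.2)
              = {p : ℝ × ℝ | p.1 ≤ p.2}.indicator
                (fun p => ‖iteratedFDeriv ℝ (k + 1 + 1) g (y + p.2 • θ)‖ₑ) := by
            ext p; simp [indicator]
          rw [this]
          exact ((hm _).comp measurable_snd).indicator (measurableSet_le measurable_fst measurable_snd)
      _ ≤ ∫⁻ s in Ioi (0 : ℝ), ENNReal.ofReal (s ^ (k + 1)) *
            ‖iteratedFDeriv ℝ (k + 1 + 1) g (y + s • θ)‖ₑ := by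
          refine setLIntegral_mono' measurableSet_Ioi fun s hs => ?_
          calc ∫⁻ t in Ioi (0 : ℝ), ENNReal.ofReal (t ^ k) * (Ici t).indicator
                (fun s => ‖iteratedFDeriv ℝ (k + 1 + 1) g (y + s • θ)‖ₑ) s
              ≤ ∫⁻ t in Ioi (0 : ℝ), (Ioc 0 s).indicator (fun _ => ENNReal.ofReal (s ^ k) *
                ‖iteratedFDeriv ℝ (k + 1 + 1) g (y + s • θ)‖ₑ) t := by
                refine setLIntegral_mono' measurableSet_Ioi fun t ht => ?_
                have ht' : (0 : ℝ) < t := ht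
                by_cases hts : t ≤ s
                · have h1 : s ∈ Ici t := hts
                  have h2 : t ∈ Ioc 0 s := ⟨ht', hts⟩
                  rw [indicator_of_mem h1, indicator_of_mem h2]
                  gcongr
                · have h1 : s ∉ Ici t := hts
                  rw [indicator_of_notMem h1, mul_zero]
                  exact zero_le
            _ = _ := by
                have hs' : (0 : ℝ) < s := hs
                rw [setLIntegral_indicator measurableSet_Ioc, inter_eq_left.2 Ioc_subset_Ioi_self,
                  setLIntegral_const, Real.volume_Ioc, sub_zero, mul_right_comm,
                  ← ENNReal.ofReal_mul (by positivity), pow_succ]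

end Potential

/-! ### Sobolev inequalities on a fixed ball. -/

section LocalSobolev

/-- The Sobolev inequality `‖g‖_{L^t} ≤ C ‖D^k g‖_{L^s}` for smooth functions supported in a fixed
ball. -/
def LocalSobolev (G : Type*) [NormedAddCommGroup G] [NormedSpace ℝ G] (n k : ℕ) (s t : ℝ≥0∞) :
    Prop :=
  ∃ C : ℝ≥0, ∀ g : EuclideanSpace ℝ (Fin n) → G, ContDiff ℝ ∞ g →
    tsupport g ⊆ Metric.closedBall 0 4 →
      eLpNorm g t volume ≤ C * eLpNorm (iteratedFDeriv ℝ k g) s volume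

/-- Averaging the ray bound over all directions and passing from polar coordinates to Lebesgue
measure bounds `|g(y)|` by the integral of `|z|^{k-n} |D^k g(y+z)|`, up to a constant. Hölder's
inequality concludes, since the kernel is in `L^{s'}` near the origin exactly when `k s > n`. -/
theorem localSobolev_top (G : Type*) [NormedAddCommGroup G] [NormedSpace ℝ G] {n k : ℕ}
    (hn : 0 < n) {s : ℝ} (hs : 1 < s) (hk : (n : ℝ) < k * s) :
    LocalSobolev G n k (ENNReal.ofReal s) ∞ := by
  have hk0 : k ≠ 0 := by
    rintro rfl
    simp at hk
    exact absurd hk (not_lt.2 (Nat.cast_nonneg n))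
  obtain ⟨k, rfl⟩ := Nat.exists_eq_succ_of_ne_zero hk0
  have : Nontrivial (EuclideanSpace ℝ (Fin n)) := by
    have : Nonempty (Fin n) := ⟨⟨0, hn⟩⟩
    infer_instance
  have hconj : s.conjExponent.HolderConjugate s := (Real.HolderConjugate.conjExponent hs).symm
  set s' := s.conjExponent with hs'
  have hs'0 : 0 < s' := hconj.pos
  have hs0 : 0 < s := by linarith
  set e : ℝ := (k + 1 : ℝ) - n with he
  set σ := (volume : Measure (EuclideanSpace ℝ (Fin n))).toSphere with hσ
  -- The kernel may be cut off at radius 9: both `y` and `y + z` lie in the ball of radius 4, so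
  -- `|z| ≤ 8`.
  set w : EuclideanSpace ℝ (Fin n) → ℝ≥0∞ := fun z =>
    (Metric.ball (0 : EuclideanSpace ℝ (Fin n)) 9).indicator (fun z => ENNReal.ofReal (‖z‖ ^ e)) z
    with hw
  have hwm : Measurable w :=
    Measurable.indicator (by fun_prop) measurableSet_ball
  have hA : (∫⁻ z, w z ^ s') ^ (1 / s') ≠ ⊤ := by
    refine ENNReal.rpow_ne_top_of_nonneg (by positivity) ?_
    have h1 : ∀ z, w z ^ s' = (Metric.ball (0 : EuclideanSpace ℝ (Fin n)) 9).indicator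
        (fun z => ENNReal.ofReal (‖z‖ ^ (e * s'))) z := fun z => by
      simp only [hw]
      by_cases hz : z ∈ Metric.ball (0 : EuclideanSpace ℝ (Fin n)) 9
      · rw [indicator_of_mem hz, indicator_of_mem hz, ENNReal.ofReal_rpow_of_nonneg
          (by positivity) hs'0.le, Real.rpow_mul (norm_nonneg _)]
      · rw [indicator_of_notMem hz, indicator_of_notMem hz, ENNReal.zero_rpow_of_pos hs'0]
    simp_rw [h1]
    rw [lintegral_indicator measurableSet_ball]
    have hint : IntegrableOn (fun z : EuclideanSpace ℝ (Fin n) => ‖z‖ ^ (e * s'))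
        (Metric.ball 0 9) volume := by
      rw [integrableOn_fun_norm_addHaar volume (f := fun y : ℝ => y ^ (e * s'))]
      have h2 : IntegrableOn (fun y : ℝ => y ^ ((n : ℝ) - 1 + e * s')) (Ioo 0 9) volume := by
        rw [intervalIntegral.integrableOn_Ioo_rpow_iff (by norm_num)]
        have h3 : s' = s / (s - 1) := rfl
        have h4 : 0 < s - 1 := by linarith
        have h5 : 0 < n + e * s' := by
          rw [h3, he]
          have : (n : ℝ) + (k + 1 - n) * (s / (s - 1)) = ((k + 1) * s - n) / (s - 1) := by
            field_simp; ring
          rw [this]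
          push_cast at hk
          exact div_pos (by linarith) h4
        linarith
      refine h2.congr_fun (fun y hy => ?_) measurableSet_Ioo
      have hy0 : (0 : ℝ) < y := hy.1
      simp only [smul_eq_mul, finrank_euclideanSpace_fin]
      rw [← Real.rpow_natCast, ← Real.rpow_add hy0, Nat.cast_pred hn]
    have := hint.2
    rw [HasFiniteIntegral] at this
    refine ne_of_lt (lt_of_le_of_lt (lintegral_mono fun z => ?_) this)
    rw [Real.enorm_eq_ofReal (by positivity)]
  have hσ0 : σ univ ≠ 0 := by
    rw [Measure.measure_univ_ne_zero]
    exact Measure.toSphere_ne_zero _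
  have hσt : σ univ ≠ ⊤ := measure_ne_top _ _
  set A := (∫⁻ z, w z ^ s') ^ (1 / s') with hAdef
  have hCt : (σ univ)⁻¹ * A ≠ ⊤ := ENNReal.mul_ne_top (ENNReal.inv_ne_top.2 hσ0) hA
  refine ⟨((σ univ)⁻¹ * A).toNNReal, fun g hg hsupp => ?_⟩
  rw [ENNReal.coe_toNNReal hCt]
  have hc : HasCompactSupport g :=
    (isCompact_closedBall _ _).of_isClosed_subset (isClosed_tsupport g) hsupp
  rw [eLpNorm_exponent_top]
  refine eLpNormEssSup_le_of_ae_enorm_bound (Filter.Eventually.of_forall fun y => ?_)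
  by_cases hy : y ∈ Metric.closedBall (0 : EuclideanSpace ℝ (Fin n)) 4
  swap
  · have : g y = 0 := image_eq_zero_of_notMem_tsupport fun h => hy (hsupp h)
    rw [this]; simp
  set D : EuclideanSpace ℝ (Fin n) → ℝ≥0∞ := fun z => ‖iteratedFDeriv ℝ (k + 1) g (y + z)‖ₑ with hD
  have hDc : Continuous (iteratedFDeriv ℝ (k + 1) g) :=
    hg.continuous_iteratedFDeriv (m := (k + 1 : ℕ)) (WithTop.coe_le_coe.2 le_top)
  have hDm : Measurable D := (hDc.comp (continuous_const.add continuous_id)).enorm.measurable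
  have hF : Measurable fun z : EuclideanSpace ℝ (Fin n) => ENNReal.ofReal (‖z‖ ^ e) * D z :=
    Measurable.mul (by fun_prop) hDm
  have h1 : σ univ * ‖g y‖ₑ ≤ ∫⁻ z : EuclideanSpace ℝ (Fin n), ENNReal.ofReal (‖z‖ ^ e) * D z := by
    rw [lintegral_polar hn hF, mul_comm, ← lintegral_const]
    refine lintegral_mono fun θ => ?_
    have hθ : ‖(θ : EuclideanSpace ℝ (Fin n))‖ = 1 := norm_eq_of_mem_sphere θ
    refine (enorm_le_lintegral_ray hg hc k y hθ).trans (le_of_eq ?_)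
    refine setLIntegral_congr_fun measurableSet_Ioi fun r hr => ?_
    have hr0 : (0 : ℝ) < r := hr
    simp only [hD]
    rw [← mul_assoc, ← ENNReal.ofReal_mul (by positivity), norm_smul, hθ, mul_one,
      Real.norm_of_nonneg hr0.le, ← Real.rpow_natCast, ← Real.rpow_natCast, ← Real.rpow_add hr0,
      Nat.cast_pred hn, he]
    congr 4
    ring
  have h2 : ∫⁻ z, ENNReal.ofReal (‖z‖ ^ e) * D z = ∫⁻ z, (w * D) z := by
    refine lintegral_congr fun z => ?_
    simp only [Pi.mul_apply, hw]
    by_cases hz : z ∈ Metric.ball (0 : EuclideanSpace ℝ (Fin n)) 9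
    · rw [indicator_of_mem hz]
    · have : D z = 0 := by
        simp only [hD]
        rw [enorm_eq_zero]
        by_contra hne
        have h3 := hsupp (support_iteratedFDeriv_subset (k + 1) hne)
        simp only [Metric.mem_closedBall, dist_zero_right, Metric.mem_ball, not_lt] at h3 hy hz
        have : ‖z‖ ≤ ‖y + z‖ + ‖y‖ := by
          simpa using norm_sub_le (y + z) y
        linarith
      rw [this, mul_zero, mul_zero]
  have h3 : ∫⁻ z, (w * D) z ≤ A * eLpNorm (iteratedFDeriv ℝ (k + 1) g) (ENNReal.ofReal s) volume := by
    refine (ENNReal.lintegral_mul_le_Lp_mul_Lq volume hconj hwm.aemeasurable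
      hDm.aemeasurable).trans (le_of_eq ?_)
    rw [eLpNorm_eq_lintegral_rpow_enorm_toReal (by simpa using hs0) ENNReal.ofReal_ne_top,
      ENNReal.toReal_ofReal hs0.le]
    congr 2
    exact lintegral_add_left_eq_self (μ := volume)
      (fun z => ‖iteratedFDeriv ℝ (k + 1) g z‖ₑ ^ s) y
  calc ‖g y‖ₑ = (σ univ)⁻¹ * (σ univ * ‖g y‖ₑ) := by
        rw [← mul_assoc, ENNReal.inv_mul_cancel hσ0 hσt, one_mul]
    _ ≤ (σ univ)⁻¹ * (A * eLpNorm (iteratedFDeriv ℝ (k + 1) g) (ENNReal.ofReal s) volume) := by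
        exact mul_le_mul' le_rfl (h1.trans (h2.trans_le h3))
    _ = _ := by rw [mul_assoc]

/-- The Gagliardo–Nirenberg–Sobolev inequality is applied below to `iteratedFDeriv`, so its value
space must be finite dimensional. -/
theorem finiteDimensional_continuousMultilinearMap (G : Type*) [NormedAddCommGroup G]
    [NormedSpace ℝ G] [FiniteDimensional ℝ G] (n j : ℕ) :
    FiniteDimensional ℝ (ContinuousMultilinearMap ℝ
      (fun _ : Fin j => EuclideanSpace ℝ (Fin n)) G) :=
  Module.Finite.of_injective
    (ContinuousMultilinearMap.toMultilinearMapLinear : ContinuousMultilinearMap ℝ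
      (fun _ : Fin j => EuclideanSpace ℝ (Fin n)) G →ₗ[ℝ] MultilinearMap ℝ
      (fun _ : Fin j => EuclideanSpace ℝ (Fin n)) G)
    ContinuousMultilinearMap.toMultilinearMap_injective

theorem localSobolev_four (G : Type*) [NormedAddCommGroup G] [NormedSpace ℝ G]
    [FiniteDimensional ℝ G] {n : ℕ} (hn : 2 ≤ n) : LocalSobolev G n ((n + 3) / 4) 2 4 := by
  have hn0 : (0 : ℝ≥0) < n := by exact_mod_cast (by omega : 0 < n)
  -- Here `1 / P j = 1/4 + j/n`, the exponent from which `j` derivatives reach `L^4`. The condition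
  -- `4 j ≤ 3 n` below says `P j ≥ 1`.
  set P : ℕ → ℝ≥0 := fun j => (4 * n) / (n + 4 * j) with hP
  have main : ∀ j : ℕ, 4 * j ≤ 3 * n → LocalSobolev G n j (P j) 4 := by
    intro j
    induction j with
    | zero =>
      intro _
      refine ⟨1, fun g hg hs => ?_⟩
      have : ((P 0 : ℝ≥0) : ℝ≥0∞) = 4 := by
        have : P 0 = 4 := by simp only [hP]; push_cast; field_simp; ring
        rw [this]; rfl
      rw [this, ENNReal.coe_one, one_mul]
      exact (eLpNorm_congr_norm_ae (Filter.Eventually.of_forall fun x => by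
        rw [norm_iteratedFDeriv_zero])).le
    | succ j ih =>
      intro hj
      obtain ⟨C, hC⟩ := ih (by omega)
      have := finiteDimensional_continuousMultilinearMap G n j
      set K := eLpNormLESNormFDerivOfLeConst (ContinuousMultilinearMap ℝ
        (fun _ : Fin j => EuclideanSpace ℝ (Fin n)) G) (volume : Measure (EuclideanSpace ℝ (Fin n)))
        (Metric.closedBall 0 4) (P (j + 1)) (P j)
      refine ⟨C * K, fun g hg hs => (hC g hg hs).trans ?_⟩
      rw [ENNReal.coe_mul, mul_assoc]
      gcongr
      have h1 : ContDiff ℝ 1 (iteratedFDeriv ℝ j g) := by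
        have : ContDiff ℝ ∞ (iteratedFDeriv ℝ j g) := contDiff_iteratedFDeriv_infty hg _
        exact this.of_le (by simp)
      have hden : (0 : ℝ≥0) < n + 4 * (j + 1 : ℕ) := by positivity
      refine (eLpNorm_le_eLpNorm_fderiv_of_le volume h1
        ((support_iteratedFDeriv_subset j).trans hs) (p := P (j + 1)) (q := P j) ?_ ?_ ?_
        Metric.isBounded_closedBall).trans (le_of_eq ?_)
      · simp only [hP]
        rw [one_le_div hden]
        exact_mod_cast (by omega : n + 4 * (j + 1) ≤ 4 * n)
      · rw [finrank_euclideanSpace_fin]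
        simp only [hP]
        rw [div_lt_iff₀ hden]
        exact_mod_cast (by nlinarith : 4 * n < n * (n + 4 * (j + 1)))
      · rw [finrank_euclideanSpace_fin]
        simp only [hP]
        have hnr : (0 : ℝ) < n := by exact_mod_cast hn0
        push_cast
        apply le_of_eq
        field_simp
        ring
      · congr 1
        exact eLpNorm_congr_norm_ae (Filter.Eventually.of_forall fun x => norm_fderiv_iteratedFDeriv)
  obtain ⟨C, hC⟩ := main ((n + 3) / 4) (by omega)
  set p := P ((n + 3) / 4) with hp
  -- This is `n ≤ 4 [(n+3)/4]`; Hölder's inequality on the ball then replaces `L^p` by `L^2`.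
  have hp2 : p ≤ 2 := by
    simp only [hp, hP]
    rw [div_le_iff₀ (by positivity)]
    exact_mod_cast (by omega : 4 * n ≤ 2 * (n + 4 * ((n + 3) / 4)))
  set B := Metric.closedBall (0 : EuclideanSpace ℝ (Fin n)) 4 with hB
  set V : ℝ≥0∞ := (volume.restrict B) univ ^ (1 / (p : ℝ≥0∞).toReal - 1 / (2 : ℝ≥0∞).toReal) with hV
  have hp0 : 0 < p := by simp only [hp, hP]; positivity
  have hVt : V ≠ ⊤ := by
    refine ENNReal.rpow_ne_top_of_nonneg ?_ ?_
    · have h2 : (p : ℝ) ≤ 2 := by exact_mod_cast hp2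
      have h0 : (0 : ℝ) < p := by exact_mod_cast hp0
      simp only [ENNReal.coe_toReal, ENNReal.toReal_ofNat, sub_nonneg]
      exact one_div_le_one_div_of_le h0 h2
    · rw [Measure.restrict_apply_univ]
      exact (isCompact_closedBall _ _).measure_ne_top
  refine ⟨C * V.toNNReal, fun g hg hs => (hC g hg hs).trans ?_⟩
  rw [ENNReal.coe_mul, ENNReal.coe_toNNReal hVt, mul_assoc]
  gcongr
  have hsup : Function.support (iteratedFDeriv ℝ ((n + 3) / 4) g) ⊆ B :=
    (support_iteratedFDeriv_subset _).trans hs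
  rw [← eLpNorm_restrict_eq_of_support_subset hsup, ← eLpNorm_restrict_eq_of_support_subset
    (p := 2) hsup, mul_comm]
  refine eLpNorm_le_eLpNorm_mul_rpow_measure_univ (by exact_mod_cast hp2) ?_
  exact (hg.continuous_iteratedFDeriv (m := ((n + 3) / 4 : ℕ))
    (WithTop.coe_le_coe.2 le_top)).aestronglyMeasurable

end LocalSobolev

/-! ### A radial mollifier. -/

section Mollifier

variable (n : ℕ)

local notation "E" => EuclideanSpace ℝ (Fin n)

/-- An unnormalised radial bump function. -/
def radialBump (z : E) : ℝ := Real.smoothTransition (1 - ‖z‖ ^ 2)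

/-- The radial mollifier of radius `δ`, of integral one. -/
def mollifier (δ : ℝ) (z : E) : ℝ :=
  (δ ^ n * ∫ x, radialBump n x)⁻¹ * radialBump n (δ⁻¹ • z)

variable {n}

theorem contDiff_radialBump : ContDiff ℝ ∞ (radialBump n) :=
  Real.smoothTransition.contDiff.comp (contDiff_const.sub (contDiff_norm_sq ℝ))

theorem radialBump_nonneg (z : E) : 0 ≤ radialBump n z := Real.smoothTransition.nonneg _

theorem radialBump_le_one (z : E) : radialBump n z ≤ 1 := Real.smoothTransition.le_one _

theorem radialBump_eq_zero {z : E} (hz : 1 ≤ ‖z‖) : radialBump n z = 0 := by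
  refine Real.smoothTransition.zero_of_nonpos ?_
  nlinarith

theorem hasCompactSupport_radialBump : HasCompactSupport (radialBump n) := by
  refine HasCompactSupport.intro (isCompact_closedBall (0 : E) 1) fun z hz => ?_
  refine radialBump_eq_zero ?_
  rw [Metric.mem_closedBall, dist_zero_right, not_le] at hz
  exact hz.le

theorem integral_radialBump_pos : 0 < ∫ x, radialBump n x := by
  refine contDiff_radialBump.continuous.integral_pos_of_hasCompactSupport_nonneg_nonzero
    hasCompactSupport_radialBump radialBump_nonneg (x := 0) ?_
  simp [radialBump, Real.smoothTransition.one]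

theorem contDiff_mollifier (δ : ℝ) : ContDiff ℝ ∞ (mollifier n δ) :=
  contDiff_const.mul (contDiff_radialBump.comp (contDiff_const_smul δ⁻¹))

theorem mollifier_nonneg {δ : ℝ} (hδ : 0 < δ) (z : E) : 0 ≤ mollifier n δ z :=
  mul_nonneg (inv_nonneg.2 (mul_nonneg (by positivity) integral_radialBump_pos.le))
    (radialBump_nonneg _)

theorem mollifier_eq_zero {δ : ℝ} (hδ : 0 < δ) {z : E} (hz : δ ≤ ‖z‖) : mollifier n δ z = 0 := by
  rw [mollifier, radialBump_eq_zero, mul_zero]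
  rw [norm_smul, norm_inv, Real.norm_of_nonneg hδ.le, inv_mul_eq_div]
  exact (one_le_div hδ).2 hz

theorem hasCompactSupport_mollifier {δ : ℝ} (hδ : 0 < δ) : HasCompactSupport (mollifier n δ) := by
  refine HasCompactSupport.intro (isCompact_closedBall (0 : E) δ) fun z hz => ?_
  refine mollifier_eq_zero hδ ?_
  rw [Metric.mem_closedBall, dist_zero_right, not_le] at hz
  exact hz.le

theorem integrable_mollifier {δ : ℝ} (hδ : 0 < δ) : Integrable (mollifier n δ) :=
  (contDiff_mollifier δ).continuous.integrable_of_hasCompactSupport (hasCompactSupport_mollifier hδ)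

theorem integral_mollifier {δ : ℝ} (hδ : 0 < δ) : ∫ z, mollifier n δ z = 1 := by
  have hI := integral_radialBump_pos (n := n)
  simp only [mollifier]
  rw [integral_const_mul, Measure.integral_comp_inv_smul_of_nonneg _ _ hδ.le,
    finrank_euclideanSpace_fin, smul_eq_mul]
  exact inv_mul_cancel₀ (by positivity)

/-- A bound by a multiple of the reciprocal volume of a ball of radius `δ`, which is the form that
Lebesgue's differentiation theorem needs. -/
theorem mollifier_le {δ : ℝ} (hδ : 0 < δ) (z x : E) :
    |mollifier n δ z| ≤ ((∫ x, radialBump n x)⁻¹ * volume.real (Metric.ball (0 : E) 1))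
      / volume.real (Metric.closedBall x δ) := by
  have hI := integral_radialBump_pos (n := n)
  have hv : 0 < volume.real (Metric.ball (0 : E) 1) :=
    ENNReal.toReal_pos (Metric.measure_ball_pos _ _ one_pos).ne' measure_ball_lt_top.ne
  rw [abs_of_nonneg (mollifier_nonneg hδ z), Measure.addHaar_real_closedBall _ _ hδ.le,
    finrank_euclideanSpace_fin]
  have e : ((∫ x, radialBump n x)⁻¹ * volume.real (Metric.ball (0 : E) 1))
      / (δ ^ n * volume.real (Metric.ball (0 : E) 1)) = (δ ^ n * ∫ x, radialBump n x)⁻¹ := by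
    field_simp
  rw [e, mollifier]
  exact mul_le_of_le_one_right (by positivity) (radialBump_le_one _)

theorem fderiv_mollifier_rotField (δ : ℝ) (i j : Fin n) (z : E) :
    fderiv ℝ (mollifier n δ) z ((rotField i j : E → E) z) = 0 := by
  have hs : Differentiable ℝ Real.smoothTransition :=
    (Real.smoothTransition.contDiff (n := 1)).differentiable (by simp)
  have h1 : HasFDerivAt (fun z : E => 1 - ‖δ⁻¹ • z‖ ^ 2)
      (-(δ⁻¹ ^ 2 • 2 • innerSL ℝ z)) z := by
    have := ((hasStrictFDerivAt_norm_sq z).hasFDerivAt.const_smul (δ⁻¹ ^ 2)).const_sub 1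
    refine this.congr_of_eventuallyEq (Filter.Eventually.of_forall fun w => ?_)
    simp [norm_smul, mul_pow]
  have h2 := ((hs _).hasDerivAt.comp_hasFDerivAt z h1).const_mul
    (δ ^ n * ∫ x, radialBump n x)⁻¹
  have e : fderiv ℝ (mollifier n δ) z = _ := h2.fderiv
  rw [e]
  have h0 : inner ℝ z ((rotField i j : E → E) z) = 0 := by
    simp only [rotField, inner_sub_right, inner_smul_right, EuclideanSpace.inner_single_right]
    simp
    ring
  simp [h0]

end Mollifier

/-! ### Radial mollification commutes with the fields. -/

section Kernel

variable {n : ℕ}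

local notation "E" => EuclideanSpace ℝ (Fin n)

variable {𝕜 : Type*} [RCLike 𝕜]

/-- The field `Y_a` in the first variable. -/
def fstField (a : YIndex n) : smoothFun (E × E) (E × E) :=
  ⟨fun p => ((yField a : E → E) p.1, 0),
    mem_smoothFun.2 (((contDiff_smoothFun (yField a)).comp contDiff_fst).prodMk contDiff_const)⟩

/-- The field `Y_a` in the second variable. -/
def sndField (a : YIndex n) : smoothFun (E × E) (E × E) :=
  ⟨fun p => (0, (yField a : E → E) p.2),
    mem_smoothFun.2 (contDiff_const.prodMk ((contDiff_smoothFun (yField a)).comp contDiff_snd))⟩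

/-- `Y_a` in the first variable as an operator. -/
def fstEnd (a : YIndex n) : Module.End ℝ (smoothFun (E × E) ℝ) := derivAlong (fstField a)

/-- `Y_a` in the second variable as an operator. -/
def sndEnd (a : YIndex n) : Module.End ℝ (smoothFun (E × E) ℝ) := derivAlong (sndField a)

theorem fstEnd_mul_sndEnd (a b : YIndex n) : fstEnd a * sndEnd b = sndEnd b * fstEnd a := by
  rw [← sub_eq_zero, fstEnd, sndEnd, derivAlong_commutator _ _ 0, map_zero]
  intro p
  have h1 : HasFDerivAt (sndField b : E × E → E × E)
      ((0 : E × E →L[ℝ] E).prod ((fderiv ℝ (yField b : E → E) p.2).comp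
        (ContinuousLinearMap.snd ℝ E E))) p :=
    (hasFDerivAt_const _ _).prodMk
      ((differentiable_smoothFun (yField b) p.2).hasFDerivAt.comp p hasFDerivAt_snd)
  have h2 : HasFDerivAt (fstField a : E × E → E × E)
      (((fderiv ℝ (yField a : E → E) p.1).comp (ContinuousLinearMap.fst ℝ E E)).prod
        (0 : E × E →L[ℝ] E)) p :=
    ((differentiable_smoothFun (yField a) p.1).hasFDerivAt.comp p hasFDerivAt_fst).prodMk
      (hasFDerivAt_const _ _)
  rw [h1.fderiv, h2.fderiv]
  simp [fstField, sndField]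

theorem fstEnd_mul_sndEnd_prod (a : YIndex n) (w : List (YIndex n)) :
    fstEnd a * (w.map sndEnd).prod = (w.map sndEnd).prod * fstEnd a := by
  induction w with
  | nil => simp
  | cons b w ih =>
    rw [List.map_cons, List.prod_cons, ← mul_assoc, fstEnd_mul_sndEnd, mul_assoc, ih, mul_assoc]

/-- The kernel `η_δ(x - y)`. -/
def mollKernel (n : ℕ) (δ : ℝ) : smoothFun (EuclideanSpace ℝ (Fin n) × EuclideanSpace ℝ (Fin n)) ℝ :=
  ⟨fun p => mollifier n δ (p.1 - p.2),
    mem_smoothFun.2 ((contDiff_mollifier δ).comp (contDiff_fst.sub contDiff_snd))⟩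

/-- The sum of the actions in `x` and in `y` is the derivative of the mollifier along `Y(x) - Y(y)`.
For a translation this vector is zero. For a rotation, linear in the point, it is `Ω(x - y)`, which
annihilates a radial function. -/
theorem fstEnd_mollKernel (δ : ℝ) (a : YIndex n) :
    fstEnd a (mollKernel n δ) = - sndEnd a (mollKernel n δ) := by
  ext p
  have h : HasFDerivAt (mollKernel n δ : E × E → ℝ) ((fderiv ℝ (mollifier n δ) (p.1 - p.2)).comp
      (ContinuousLinearMap.fst ℝ E E - ContinuousLinearMap.snd ℝ E E)) p :=
    HasFDerivAt.comp (f := fun p : E × E => p.1 - p.2) p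
      (((contDiff_mollifier δ).differentiable (by simp)) (p.1 - p.2)).hasFDerivAt
      (hasFDerivAt_fst.sub hasFDerivAt_snd)
  have h0 : fderiv ℝ (mollifier n δ) (p.1 - p.2)
      ((yField a : E → E) p.1 - (yField a : E → E) p.2) = 0 := by
    rcases a with i | q
    · simp [yField, coordField]
    · have e : (yField (Sum.inr q) : E → E) p.1 - (yField (Sum.inr q) : E → E) p.2
          = (rotField q.1.1 q.1.2 : E → E) (p.1 - p.2) := by
        simp only [yField, rotField, PiLp.sub_apply, sub_smul]
        abel
      rw [e, fderiv_mollifier_rotField]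
  rw [map_sub] at h0
  simp only [fstEnd, sndEnd, derivAlong_apply, Submodule.coe_neg, Pi.neg_apply, h.fderiv]
  simp only [fstField, sndField, ContinuousLinearMap.comp_apply, _root_.sub_apply,
    ContinuousLinearMap.coe_fst', ContinuousLinearMap.coe_snd', sub_zero, zero_sub, map_neg]
  linarith

/-- Each letter in `x` commutes past the letters already moved to `y` before reaching the kernel, so
the order is reversed. This is the order of the formal adjoint in `yRev`. -/
theorem fstEnd_prod_mollKernel (δ : ℝ) (w : List (YIndex n)) :
    (w.map fstEnd).prod (mollKernel n δ)
      = (-1 : ℝ) ^ w.length • (w.reverse.map sndEnd).prod (mollKernel n δ) := by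
  induction w with
  | nil => simp
  | cons a w ih =>
    rw [List.map_cons, List.prod_cons, Module.End.mul_apply, ih, map_smul,
      ← Module.End.mul_apply, fstEnd_mul_sndEnd_prod, Module.End.mul_apply, fstEnd_mollKernel,
      List.reverse_cons, List.map_append, List.prod_append, Module.End.mul_apply, map_neg,
      List.length_cons, pow_succ, mul_smul, smul_neg]
    simp

/-- Freezing the first variable. -/
def sliceSnd (x : E) (F : smoothFun (E × E) ℝ) : smoothFun E ℝ :=
  ⟨fun y => (F : E × E → ℝ) (x, y),
    mem_smoothFun.2 ((contDiff_smoothFun F).comp (contDiff_const.prodMk contDiff_id))⟩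

theorem sliceSnd_sndEnd (x : E) (F : smoothFun (E × E) ℝ) (a : YIndex n) :
    sliceSnd x (sndEnd a F) = yEnd ℝ a (sliceSnd x F) := by
  ext y
  have h : HasFDerivAt (fun y => (F : E × E → ℝ) (x, y)) ((fderiv ℝ (F : E × E → ℝ) (x, y)).comp
      ((0 : E →L[ℝ] E).prod (ContinuousLinearMap.id ℝ E))) y :=
    (differentiable_smoothFun F (x, y)).hasFDerivAt.comp y
      ((hasFDerivAt_const _ _).prodMk (hasFDerivAt_id y))
  simp only [yEnd, derivAlong_apply, sliceSnd, h.fderiv]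
  simp [sndEnd, sndField]

theorem sliceSnd_sndEnd_prod (x : E) (F : smoothFun (E × E) ℝ) (w : List (YIndex n)) :
    sliceSnd x ((w.map sndEnd).prod F) = (w.map (yEnd ℝ)).prod (sliceSnd x F) := by
  induction w with
  | nil => simp
  | cons a w ih =>
    rw [List.map_cons, List.prod_cons, Module.End.mul_apply, sliceSnd_sndEnd, ih, List.map_cons,
      List.prod_cons, Module.End.mul_apply]

theorem coe_yEnd_pow (a : YIndex n) (m : ℕ) (φ : smoothFun E ℝ) :
    ((yEnd ℝ a ^ m) φ : E → ℝ) = (yOp a)^[m] (φ : E → ℝ) := by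
  induction m generalizing φ with
  | zero => simp
  | succ m ih =>
    rw [pow_succ, Module.End.mul_apply, ih, Function.iterate_succ_apply]
    congr 1
    ext x
    simp [yEnd, yOp, yField_apply]

theorem coe_yEnd_reverse (μ : YMulti n) (φ : smoothFun E ℝ) :
    (((yWord μ).reverse.map (yEnd ℝ)).prod φ : E → ℝ) = yRev μ (φ : E → ℝ) := by
  unfold yWord yRev
  induction yList n generalizing φ with
  | nil => simp
  | cons a l ih =>
    rw [List.foldl_cons, ← coe_yEnd_pow, ← ih, List.flatMap_cons, List.reverse_append,
      List.map_append, List.prod_append, Module.End.mul_apply]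
    simp

theorem tsupport_yEnd_subset (a : YIndex n) (φ : smoothFun E ℝ) :
    tsupport (yEnd ℝ a φ : E → ℝ) ⊆ tsupport (φ : E → ℝ) := by
  refine closure_minimal (fun x hx => ?_) (isClosed_tsupport _)
  refine support_fderiv_subset ℝ ?_
  intro h
  apply hx
  simp [yEnd, h]

theorem tsupport_yEnd_prod_subset (w : List (YIndex n)) (φ : smoothFun E ℝ) :
    tsupport ((w.map (yEnd ℝ)).prod φ : E → ℝ) ⊆ tsupport (φ : E → ℝ) := by
  induction w with
  | nil => simp
  | cons a w ih =>
    rw [List.map_cons, List.prod_cons, Module.End.mul_apply]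
    exact (tsupport_yEnd_subset a _).trans ih

theorem hasFDerivAt_fst_slice (F : smoothFun (E × E) ℝ) (x y : E) :
    HasFDerivAt (fun x => (F : E × E → ℝ) (x, y)) ((fderiv ℝ (F : E × E → ℝ) (x, y)).comp
      (ContinuousLinearMap.inl ℝ E E)) x :=
  (differentiable_smoothFun F (x, y)).hasFDerivAt.comp x
    ((hasFDerivAt_id x).prodMk (hasFDerivAt_const _ _))

variable {u : EuclideanSpace ℝ (Fin n) → 𝕜} {K : Set (EuclideanSpace ℝ (Fin n))}

theorem integrable_smul_of_compact (hu : Integrable u) (hK : IsCompact K)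
    (huK : ∀ y ∉ K, u y = 0) {f : E → ℝ} (hf : Continuous f) : Integrable fun y => f y • u y := by
  obtain ⟨C, hC⟩ := hK.exists_bound_of_continuousOn hf.continuousOn
  refine Integrable.mono (hu.const_mul (algebraMap ℝ 𝕜 C))
    (hf.aestronglyMeasurable.smul hu.1) (Filter.Eventually.of_forall fun y => ?_)
  by_cases hy : y ∈ K
  · rw [norm_smul, norm_mul]
    gcongr
    refine (hC y hy).trans ?_
    simpa using le_abs_self C
  · simp [huK y hy]

theorem hasFDerivAt_integral_smul (hu : Integrable u) (hK : IsCompact K)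
    (huK : ∀ y ∉ K, u y = 0) (F : smoothFun (E × E) ℝ) (x : E) :
    HasFDerivAt (fun x => ∫ y, (F : E × E → ℝ) (x, y) • u y)
      (∫ y, ((fderiv ℝ (F : E × E → ℝ) (x, y)).comp
        (ContinuousLinearMap.inl ℝ E E)).smulRight (u y)) x := by
  have hc : Continuous (fun p : E × E => (fderiv ℝ (F : E × E → ℝ) p).comp
      (ContinuousLinearMap.inl ℝ E E)) :=
    ((contDiff_smoothFun F).continuous_fderiv (by simp)).clm_comp continuous_const
  obtain ⟨C, hC⟩ := ((isCompact_closedBall x 1).prod hK).exists_bound_of_continuousOn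
    hc.continuousOn
  refine hasFDerivAt_integral_of_dominated_of_fderiv_le (𝕜 := ℝ)
    (F' := fun x y => ((fderiv ℝ (F : E × E → ℝ) (x, y)).comp
        (ContinuousLinearMap.inl ℝ E E)).smulRight (u y))
    (bound := fun y => |C| * ‖u y‖) (Metric.closedBall_mem_nhds x one_pos)
    (Filter.Eventually.of_forall fun x' => ?_) ?_ ?_ (Filter.Eventually.of_forall fun y x' hx' => ?_)
    (hu.norm.const_mul _) (Filter.Eventually.of_forall fun y x' _ => ?_)
  · exact ((contDiff_smoothFun F).continuous.comp
      (continuous_const.prodMk continuous_id)).aestronglyMeasurable.smul hu.1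
  · exact integrable_smul_of_compact hu hK huK
      ((contDiff_smoothFun F).continuous.comp (continuous_const.prodMk continuous_id))
  · have h1 : Continuous fun y : E => (fderiv ℝ (F : E × E → ℝ) (x, y)).comp
      (ContinuousLinearMap.inl ℝ E E) := hc.comp (continuous_const.prodMk continuous_id)
    exact (ContinuousLinearMap.smulRightL ℝ E 𝕜).aestronglyMeasurable_comp₂
      h1.aestronglyMeasurable hu.1
  · by_cases hy : y ∈ K
    · rw [ContinuousLinearMap.norm_smulRight_apply]
      gcongr
      exact (hC (x', y) ⟨hx', hy⟩).trans (le_abs_self C)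
    · simp [huK y hy]
  · exact (hasFDerivAt_fst_slice F x' y).smul_const (u y)

theorem fderiv_integral_smul_apply (hu : Integrable u) (hK : IsCompact K)
    (huK : ∀ y ∉ K, u y = 0) (F : smoothFun (E × E) ℝ) (x v : E) :
    fderiv ℝ (fun x => ∫ y, (F : E × E → ℝ) (x, y) • u y) x v
      = ∫ y, fderiv ℝ (F : E × E → ℝ) (x, y) (v, 0) • u y := by
  rw [(hasFDerivAt_integral_smul hu hK huK F x).fderiv, ContinuousLinearMap.integral_apply]
  · rfl
  · have hc : Continuous (fun p : E × E => (fderiv ℝ (F : E × E → ℝ) p).comp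
      (ContinuousLinearMap.inl ℝ E E)) :=
      ((contDiff_smoothFun F).continuous_fderiv (by simp)).clm_comp continuous_const
    have h1 : Continuous fun y : E => (fderiv ℝ (F : E × E → ℝ) (x, y)).comp
      (ContinuousLinearMap.inl ℝ E E) := hc.comp (continuous_const.prodMk continuous_id)
    refine Integrable.mono (g := fun y => ‖(fderiv ℝ (F : E × E → ℝ) (x, y)).comp
      (ContinuousLinearMap.inl ℝ E E)‖ • u y) (integrable_smul_of_compact hu hK huK h1.norm) ?_
      (Filter.Eventually.of_forall fun y => ?_)
    · exact (ContinuousLinearMap.smulRightL ℝ E 𝕜).aestronglyMeasurable_comp₂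
        h1.aestronglyMeasurable hu.1
    · rw [ContinuousLinearMap.norm_smulRight_apply, norm_smul, norm_norm]

/-- The partial derivatives are integrals of the same form, with `F` replaced by a derivative of `F`
in its first variable; hence the induction over all `F`. -/
theorem contDiff_integral_smul (hu : Integrable u) (hK : IsCompact K)
    (huK : ∀ y ∉ K, u y = 0) (F : smoothFun (E × E) ℝ) :
    ContDiff ℝ ∞ (fun x => ∫ y, (F : E × E → ℝ) (x, y) • u y) := by
  rw [contDiff_infty]
  intro m
  induction m generalizing F with
  | zero =>
    refine contDiff_zero.2 (continuous_iff_continuousAt.2 fun x => ?_)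
    exact (hasFDerivAt_integral_smul hu hK huK F x).continuousAt
  | succ m ih =>
    refine contDiff_succ_iff_fderiv.2 ⟨fun x =>
      (hasFDerivAt_integral_smul hu hK huK F x).differentiableAt, fun h => absurd h (WithTop.coe_ne_top (a := (m : ℕ∞))), ?_⟩
    have e : fderiv ℝ (fun x => ∫ y, (F : E × E → ℝ) (x, y) • u y) = fun x => ∑ i,
        ContinuousLinearMap.smulRightL ℝ E 𝕜 (EuclideanSpace.proj (𝕜 := ℝ) i)
          (∫ y, (fstEnd (Sum.inl i) F : E × E → ℝ) (x, y) • u y) := by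
      ext x v
      conv_lhs => rw [← (EuclideanSpace.basisFun (Fin n) ℝ).sum_repr v, map_sum]
      rw [sum_apply]
      refine Finset.sum_congr rfl fun i _ => ?_
      rw [map_smul, fderiv_integral_smul_apply hu hK huK]
      simp [fstEnd, fstField, yField, coordField]
    rw [e]
    exact ContDiff.sum fun i _ => (ContinuousLinearMap.contDiff _).comp (ih _)

/-- The smooth function `x ↦ ∫ F(x, y) u(y) dy`. -/
def kernelInt (hu : Integrable u) (hK : IsCompact K) (huK : ∀ y ∉ K, u y = 0)
    (F : smoothFun (E × E) ℝ) : smoothFun E 𝕜 :=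
  ⟨fun x => ∫ y, (F : E × E → ℝ) (x, y) • u y,
    mem_smoothFun.2 (contDiff_integral_smul hu hK huK F)⟩

theorem yEnd_prod_kernelInt (hu : Integrable u) (hK : IsCompact K) (huK : ∀ y ∉ K, u y = 0)
    (F : smoothFun (E × E) ℝ) (w : List (YIndex n)) :
    (w.map (yEnd 𝕜)).prod (kernelInt hu hK huK F)
      = kernelInt hu hK huK ((w.map fstEnd).prod F) := by
  induction w with
  | nil => simp
  | cons a w ih =>
    rw [List.map_cons, List.prod_cons, Module.End.mul_apply, ih, List.map_cons, List.prod_cons,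
      Module.End.mul_apply]
    ext x
    exact fderiv_integral_smul_apply hu hK huK _ x _

/-- Mollification with the radial mollifier. -/
def mollify (δ : ℝ) (v : E → 𝕜) (x : E) : 𝕜 := ∫ y, mollifier n δ (x - y) • v y

/-- Radial mollification commutes with the weak derivatives `Y^μ`. -/
theorem yPow_kernelInt_mollKernel {U : Set E} {μ : YMulti n} {u v : E → 𝕜} (h : HasWeakY U μ u v)
    {K : Set E} (hK : IsCompact K) (hKU : K ⊆ U) (hu : Integrable (K.indicator u))
    (huK : ∀ y ∉ K, K.indicator u y = 0)
    {δ : ℝ} (hδ : 0 < δ) {x : E} (hx : Metric.closedBall x δ ⊆ K) :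
    (yPow 𝕜 μ (kernelInt hu hK huK (mollKernel n δ)) : E → 𝕜) x = mollify δ v x := by
  set φ : smoothFun E ℝ := sliceSnd x (mollKernel n δ) with hφ
  have hsupp : tsupport (φ : E → ℝ) ⊆ Metric.closedBall x δ := by
    refine closure_minimal (fun y hy => ?_) Metric.isClosed_closedBall
    by_contra hne
    apply hy
    refine mollifier_eq_zero hδ ?_
    rw [Metric.mem_closedBall, dist_comm, dist_eq_norm, not_le] at hne
    exact hne.le
  have hcs : HasCompactSupport (φ : E → ℝ) :=
    (isCompact_closedBall x δ).of_isClosed_subset (isClosed_tsupport _) hsupp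
  have hweak := h.integral_eq φ (contDiff_smoothFun φ) hcs (hsupp.trans (hx.trans hKU))
  rw [yPow, yEnd_prod_kernelInt, fstEnd_prod_mollKernel, length_yWord]
  have e : ∀ y, ((-1 : ℝ) ^ yLen μ • ((yWord μ).reverse.map sndEnd).prod (mollKernel n δ) :
      E × E → ℝ) (x, y) • K.indicator u y = (-1 : ℝ) ^ yLen μ • (yRev μ (φ : E → ℝ) y • u y) := by
    intro y
    have e1 : (((yWord μ).reverse.map sndEnd).prod (mollKernel n δ) : E × E → ℝ) (x, y)
        = yRev μ (φ : E → ℝ) y := by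
      rw [← coe_yEnd_reverse, hφ, ← sliceSnd_sndEnd_prod]
      rfl
    rw [Pi.smul_apply, e1, smul_assoc]
    by_cases hy : y ∈ K
    · rw [indicator_of_mem hy]
    -- The test function lives in the ball around `x`, contained in `K`, so restricting `u` to `K`
    -- changes nothing.
    · have : yRev μ (φ : E → ℝ) y = 0 := by
        rw [← coe_yEnd_reverse]
        refine image_eq_zero_of_notMem_tsupport fun hmem => hy (hx (hsupp ?_))
        exact tsupport_yEnd_prod_subset _ _ hmem
      rw [this, zero_smul, zero_smul]
  change ∫ y, ((-1 : ℝ) ^ yLen μ • ((yWord μ).reverse.map sndEnd).prod (mollKernel n δ) :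
      E × E → ℝ) (x, y) • K.indicator u y = _
  simp_rw [e]
  -- The sign from moving derivatives to `y` cancels the sign in the definition of the weak
  -- derivative.
  rw [integral_smul, hweak, smul_smul, ← mul_pow]
  simp [mollify, hφ, sliceSnd, mollKernel]

end Kernel

/-! ### Convergence and boundedness of mollification. -/

section Approximation

variable {n : ℕ}

local notation "E" => EuclideanSpace ℝ (Fin n)

variable {𝕜 : Type*} [RCLike 𝕜]

theorem ae_tendsto_mollify {g : E → 𝕜} (hg : LocallyIntegrable g) {δ : ℕ → ℝ}
    (hδ : ∀ j, 0 < δ j) (hlim : Filter.Tendsto δ Filter.atTop (nhds 0)) :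
    ∀ᵐ x, Filter.Tendsto (fun j => mollify (δ j) g x) Filter.atTop (nhds (g x)) := by
  filter_upwards [(Besicovitch.vitaliFamily volume).ae_tendsto_average_norm_sub hg] with x hx
  have hδ' : Filter.Tendsto δ Filter.atTop (nhdsWithin 0 (Ioi 0)) :=
    tendsto_nhdsWithin_iff.2 ⟨hlim, Filter.Eventually.of_forall hδ⟩
  have := (hx.comp (Besicovitch.tendsto_filterAt volume x)).comp hδ'
  refine tendsto_integral_smul_of_tendsto_average_norm_sub
    ((∫ x, radialBump n x)⁻¹ * volume.real (Metric.ball (0 : E) 1)) this ?_ ?_ ?_ ?_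
  · exact Filter.Eventually.of_forall fun j =>
      hg.integrableOn_isCompact (isCompact_closedBall _ _)
  · refine tendsto_const_nhds.congr fun j => ?_
    rw [integral_sub_left_eq_self (fun z => mollifier n (δ j) z) volume x,
      integral_mollifier (hδ j)]
  · refine Filter.Eventually.of_forall fun j y hy => ?_
    by_contra hne
    apply hy
    refine mollifier_eq_zero (hδ j) ?_
    rw [Metric.mem_closedBall, dist_comm, dist_eq_norm, not_le] at hne
    exact hne.le
  · exact Filter.Eventually.of_forall fun j y => mollifier_le (hδ j) _ _

/-- Jensen's inequality for the probability density `y ↦ mollifier n δ (x - y)`, then Tonelli and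
unit mass in `x`. The hypothesis `h` ensures that only values of `v` on `A` are seen from `A'`. -/
theorem eLpNorm_mollify_le {s : ℝ≥0∞} (hs1 : 1 ≤ s) (hst : s ≠ ⊤) {v : E → 𝕜}
    (hv : StronglyMeasurable v) {δ : ℝ} (hδ : 0 < δ) {A A' : Set E} (hA : MeasurableSet A)
    (hA' : MeasurableSet A') (h : ∀ x ∈ A', Metric.closedBall x δ ⊆ A) :
    eLpNorm (mollify δ v) s (volume.restrict A') ≤ eLpNorm v s (volume.restrict A) := by
  have hs0 : s ≠ 0 := (zero_lt_one.trans_le hs1).ne'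
  set p := s.toReal with hp
  have hp1 : 1 ≤ p := by
    rw [hp, ← ENNReal.toReal_one]
    exact ENNReal.toReal_mono hst hs1
  have hp0 : 0 < p := zero_lt_one.trans_le hp1
  set k : E → ℝ≥0∞ := fun z => ENNReal.ofReal (mollifier n δ z) with hk
  have hkm : Measurable k := (contDiff_mollifier δ).continuous.measurable.ennreal_ofReal
  have hkint : ∫⁻ z, k z = 1 := by
    rw [← ofReal_integral_eq_lintegral_ofReal (integrable_mollifier hδ)
      (Filter.Eventually.of_forall (mollifier_nonneg hδ)), integral_mollifier hδ, ENNReal.ofReal_one]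
  have hkx : ∀ x : E, Measurable fun y => k (x - y) := fun x =>
    hkm.comp (measurable_const.sub measurable_id)
  have hvm : Measurable fun y => ‖v y‖ₑ := hv.enorm
  have jensen : ∀ x, ‖mollify δ v x‖ₑ ^ p ≤ ∫⁻ y, k (x - y) * ‖v y‖ₑ ^ p := by
    intro x
    set P : Measure E := volume.withDensity fun y => k (x - y) with hP
    have : IsProbabilityMeasure P := ⟨by
      rw [hP, withDensity_apply _ MeasurableSet.univ, Measure.restrict_univ,
        lintegral_sub_left_eq_self k x, hkint]⟩
    have h1 : ‖mollify δ v x‖ₑ ≤ eLpNorm v 1 P := by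
      rw [eLpNorm_one_eq_lintegral_enorm, hP,
        lintegral_withDensity_eq_lintegral_mul _ (hkx x) hvm]
      refine (enorm_integral_le_lintegral_enorm _).trans (le_of_eq (lintegral_congr fun y => ?_))
      rw [enorm_smul, Pi.mul_apply, hk, Real.enorm_of_nonneg (mollifier_nonneg hδ _)]
    have h2 := eLpNorm_le_eLpNorm_of_exponent_le (μ := P) hs1 hv.aestronglyMeasurable
    have h3 := ENNReal.rpow_le_rpow (h1.trans h2) hp0.le
    refine h3.trans (le_of_eq ?_)
    rw [eLpNorm_eq_lintegral_rpow_enorm_toReal hs0 hst, ← hp, ← ENNReal.rpow_mul, one_div,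
      inv_mul_cancel₀ hp0.ne', ENNReal.rpow_one, hP,
      lintegral_withDensity_eq_lintegral_mul _ (hkx x) (hvm.pow_const p)]
    rfl
  rw [eLpNorm_eq_lintegral_rpow_enorm_toReal hs0 hst, eLpNorm_eq_lintegral_rpow_enorm_toReal hs0 hst,
    ← hp]
  refine ENNReal.rpow_le_rpow ?_ (by positivity)
  calc ∫⁻ x in A', ‖mollify δ v x‖ₑ ^ p
      ≤ ∫⁻ x in A', ∫⁻ y, k (x - y) * A.indicator (fun y => ‖v y‖ₑ ^ p) y := by
        refine setLIntegral_mono' hA' fun x hx => (jensen x).trans (lintegral_mono fun y => ?_)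
        by_cases hy : y ∈ A
        · rw [indicator_of_mem hy]
        · have : k (x - y) = 0 := by
            simp only [hk]
            rw [mollifier_eq_zero hδ, ENNReal.ofReal_zero]
            by_contra hlt
            rw [not_le, ← dist_eq_norm, dist_comm] at hlt
            exact hy (h x hx hlt.le)
          rw [this, zero_mul, zero_mul]
    _ ≤ ∫⁻ x, ∫⁻ y, k (x - y) * A.indicator (fun y => ‖v y‖ₑ ^ p) y := setLIntegral_le_lintegral _ _
    _ = ∫⁻ y, ∫⁻ x, k (x - y) * A.indicator (fun y => ‖v y‖ₑ ^ p) y := by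
        refine lintegral_lintegral_swap (Measurable.aemeasurable ?_)
        exact (hkm.comp (measurable_fst.sub measurable_snd)).mul
          (((hvm.pow_const p).indicator hA).comp measurable_snd)
    _ = ∫⁻ y, A.indicator (fun y => ‖v y‖ₑ ^ p) y := by
        refine lintegral_congr fun y => ?_
        have hky : Measurable fun x => k (x - y) := hkm.comp (measurable_id.sub measurable_const)
        rw [lintegral_mul_const _ hky,
          lintegral_sub_right_eq_self k y, hkint, one_mul]
    _ = ∫⁻ y in A, ‖v y‖ₑ ^ p := lintegral_indicator hA _

end Approximation

/-! ### The shift-invariant measure `dr dω`. -/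

section Cylinder

variable {n : ℕ}

local notation "E" => EuclideanSpace ℝ (Fin n)
local notation "S" => Metric.sphere (0 : EuclideanSpace ℝ (Fin n)) 1
local notation "σ" => Measure.toSphere (volume : Measure (EuclideanSpace ℝ (Fin n)))

theorem measurable_smul_sphere : Measurable fun p : ℝ × S => p.1 • (p.2 : E) := by fun_prop

variable (n) in
/-- The measure `dr dω` on the set of `r ω` with `r ∈ J`. -/
def cylMeasure (J : Set ℝ) : Measure (EuclideanSpace ℝ (Fin n)) :=
  Measure.map (fun p : ℝ × S => p.1 • (p.2 : E)) ((volume.restrict J).prod σ)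

theorem lintegral_cylMeasure (J : Set ℝ) {F : E → ℝ≥0∞} (hF : Measurable F) :
    ∫⁻ x, F x ∂(cylMeasure n J) = ∫⁻ r in J, (∫⁻ θ : S, F (r • (θ : E)) ∂σ) := by
  rw [cylMeasure, lintegral_map hF measurable_smul_sphere]
  exact lintegral_prod (fun p : ℝ × S => F (p.1 • (p.2 : E)))
    (hF.comp measurable_smul_sphere).aemeasurable

theorem cylMeasure_mono {J J' : Set ℝ} (h : J ⊆ J') : cylMeasure n J ≤ cylMeasure n J' := by
  refine Measure.le_iff.2 fun s hs => ?_
  rw [← lintegral_indicator_one hs, ← lintegral_indicator_one hs,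
    lintegral_cylMeasure J (measurable_one.indicator hs),
    lintegral_cylMeasure J' (measurable_one.indicator hs)]
  exact lintegral_mono_set h

theorem ae_norm_mem_cylMeasure {J : Set ℝ} (hJ : MeasurableSet J) (hJ0 : J ⊆ Ioi 0) :
    ∀ᵐ x ∂(cylMeasure n J), ‖x‖ ∈ J := by
  rw [cylMeasure, ae_map_iff measurable_smul_sphere.aemeasurable (measurable_norm hJ)]
  have h : ∀ᵐ r ∂(volume.restrict J), r ∈ J := ae_restrict_mem hJ
  filter_upwards [(Measure.quasiMeasurePreserving_fst (ν := σ)).ae h] with p hp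
  have h0 : (0 : ℝ) < p.1 := hJ0 hp
  rwa [norm_smul, norm_eq_of_mem_sphere, mul_one, Real.norm_of_nonneg h0.le]

theorem volume_restrict_apply_polar (hn : 0 < n) {J : Set ℝ} (hJ : MeasurableSet J)
    (hJ0 : J ⊆ Ioi 0) {s : Set E} (hs : MeasurableSet s) :
    (volume.restrict {x : E | ‖x‖ ∈ J}) s = ∫⁻ θ : S,
      (∫⁻ r in J, ENNReal.ofReal (r ^ (n - 1)) * s.indicator 1 (r • (θ : E))) ∂σ := by
  have hA : MeasurableSet {x : E | ‖x‖ ∈ J} := measurable_norm hJ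
  rw [Measure.restrict_apply hs, ← lintegral_indicator_one (hs.inter hA),
    lintegral_polar hn (measurable_one.indicator (hs.inter hA))]
  refine lintegral_congr fun θ => ?_
  have e : ∀ r ∈ Ioi (0 : ℝ), ENNReal.ofReal (r ^ (n - 1)) *
      (s ∩ {x : E | ‖x‖ ∈ J}).indicator (1 : E → ℝ≥0∞) (r • (θ : E))
      = J.indicator (fun r => ENNReal.ofReal (r ^ (n - 1)) * s.indicator 1 (r • (θ : E))) r := by
    intro r hr
    have hr0 : (0 : ℝ) < r := hr
    have hnorm : ‖r • (θ : E)‖ = r := by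
      rw [norm_smul, norm_eq_of_mem_sphere, mul_one, Real.norm_of_nonneg hr0.le]
    by_cases hrJ : r ∈ J
    · rw [indicator_of_mem hrJ]
      congr 1
      by_cases hrs : r • (θ : E) ∈ s
      · have hmem : r • (θ : E) ∈ s ∩ {x : E | ‖x‖ ∈ J} :=
          ⟨hrs, by rw [mem_ofPred_eq, hnorm]; exact hrJ⟩
        rw [indicator_of_mem hrs, indicator_of_mem hmem]
      · rw [indicator_of_notMem hrs, indicator_of_notMem fun h => hrs h.1]
    · rw [indicator_of_notMem hrJ, indicator_of_notMem, mul_zero]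
      intro h
      have := h.2
      rw [mem_ofPred_eq, hnorm] at this
      exact hrJ this
  rw [setLIntegral_congr_fun measurableSet_Ioi e, setLIntegral_indicator hJ,
    inter_eq_left.2 hJ0]

theorem cylMeasure_apply (J : Set ℝ) {s : Set E} (hs : MeasurableSet s) :
    cylMeasure n J s = ∫⁻ θ : S, (∫⁻ r in J, s.indicator 1 (r • (θ : E))) ∂σ := by
  have hF : Measurable (s.indicator (1 : E → ℝ≥0∞)) := measurable_one.indicator hs
  rw [← lintegral_indicator_one hs, cylMeasure, lintegral_map hF measurable_smul_sphere]
  exact lintegral_prod_symm (fun p : ℝ × S => s.indicator (1 : E → ℝ≥0∞) (p.1 • (p.2 : E)))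
    (hF.comp measurable_smul_sphere).aemeasurable

theorem volume_restrict_le_smul_cylMeasure (hn : 0 < n) {J : Set ℝ} (hJ : MeasurableSet J)
    (hJ0 : J ⊆ Ioi 0) {c : ℝ} (hc : ∀ r ∈ J, r ≤ c) :
    volume.restrict {x : E | ‖x‖ ∈ J} ≤ ENNReal.ofReal (c ^ (n - 1)) • cylMeasure n J := by
  refine Measure.le_iff.2 fun s hs => ?_
  rw [Measure.smul_apply, volume_restrict_apply_polar hn hJ hJ0 hs, cylMeasure_apply J hs,
    smul_eq_mul, ← lintegral_const_mul' _ _ ENNReal.ofReal_ne_top]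
  refine lintegral_mono fun θ => ?_
  rw [← lintegral_const_mul' _ _ ENNReal.ofReal_ne_top]
  refine setLIntegral_mono' hJ fun r hr => ?_
  have hr0 : (0 : ℝ) < r := hJ0 hr
  gcongr
  exact hc r hr

theorem smul_cylMeasure_le_volume_restrict (hn : 0 < n) {J : Set ℝ} (hJ : MeasurableSet J)
    {b : ℝ} (hb0 : 0 < b) (hb : ∀ r ∈ J, b ≤ r) :
    ENNReal.ofReal (b ^ (n - 1)) • cylMeasure n J ≤ volume.restrict {x : E | ‖x‖ ∈ J} := by
  refine Measure.le_iff.2 fun s hs => ?_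
  rw [Measure.smul_apply, volume_restrict_apply_polar hn hJ (fun r hr => hb0.trans_le (hb r hr)) hs,
    cylMeasure_apply J hs, smul_eq_mul, ← lintegral_const_mul' _ _ ENNReal.ofReal_ne_top]
  refine lintegral_mono fun θ => ?_
  rw [← lintegral_const_mul' _ _ ENNReal.ofReal_ne_top]
  refine setLIntegral_mono' hJ fun r hr => ?_
  gcongr
  exact hb r hr

theorem cylMeasure_le_volume_restrict (hn : 0 < n) {J : Set ℝ} (hJ : MeasurableSet J)
    (hJ1 : ∀ r ∈ J, 1 ≤ r) : cylMeasure n J ≤ volume.restrict {x : E | ‖x‖ ∈ J} := by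
  have := smul_cylMeasure_le_volume_restrict hn hJ one_pos hJ1
  simpa using this

theorem measurable_radialShift (a : ℝ) : Measurable (radialShift a : E → E) := by
  unfold radialShift
  fun_prop

/-- In polar coordinates the shift is the translation `r ↦ r + a`, which preserves `dr` but not
`r^{n-1} dr`. The hypothesis `hJ0` keeps the radii before the shift positive. -/
theorem map_radialShift_cylMeasure (a : ℝ) {J : Set ℝ} (hJ : MeasurableSet J)
    (hJ0 : ∀ r ∈ J, a < r) :
    Measure.map (radialShift a) (cylMeasure n ((· + a) ⁻¹' J)) = cylMeasure n J := by
  have hJ' : MeasurableSet ((· + a) ⁻¹' J) := measurable_add_const a hJ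
  rw [cylMeasure, Measure.map_map (measurable_radialShift a) measurable_smul_sphere]
  have hcongr : (radialShift a ∘ fun p : ℝ × S => p.1 • (p.2 : E))
      =ᵐ[(volume.restrict ((· + a) ⁻¹' J)).prod σ]
      ((fun p : ℝ × S => p.1 • (p.2 : E)) ∘ Prod.map (· + a) id) := by
    have h : ∀ᵐ r ∂(volume.restrict ((· + a) ⁻¹' J)), r ∈ ((· + a) ⁻¹' J) := ae_restrict_mem hJ'
    filter_upwards [(Measure.quasiMeasurePreserving_fst (ν := σ)).ae h] with p hp
    have h0 : 0 < p.1 := by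
      have := hJ0 _ hp
      linarith
    exact radialShift_smul a h0 (norm_eq_of_mem_sphere p.2)
  rw [Measure.map_congr hcongr, ← Measure.map_map measurable_smul_sphere
    ((measurable_add_const a).prodMap measurable_id)]
  have hmp := ((measurePreserving_add_right volume a).restrict_preimage hJ).prod
    (MeasurePreserving.id σ)
  rw [hmp.map_eq, cylMeasure]

theorem eLpNorm_comp_radialShift {G : Type*} [NormedAddCommGroup G] (a : ℝ) {J : Set ℝ}
    (hJ : MeasurableSet J) (hJ0 : ∀ r ∈ J, a < r) {f : E → G} (hf : StronglyMeasurable f)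
    (t : ℝ≥0∞) :
    eLpNorm (fun y => f (radialShift a y)) t (cylMeasure n ((· + a) ⁻¹' J))
      = eLpNorm f t (cylMeasure n J) := by
  rw [← map_radialShift_cylMeasure a hJ hJ0,
    eLpNorm_map_measure hf.aestronglyMeasurable (measurable_radialShift a).aemeasurable]
  rfl

end Cylinder

/-! ### Uniform estimates on annuli of unit width. -/

section LocalEstimate

variable {n : ℕ}

local notation "E" => EuclideanSpace ℝ (Fin n)

/-- A radial cutoff, equal to `1` for `2 ≤ |y| ≤ 3` and supported in `3/2 ≤ |y| ≤ 7/2`. -/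
def annulusCutoff (n : ℕ) (y : EuclideanSpace ℝ (Fin n)) : ℝ :=
  Real.smoothTransition ((‖y‖ ^ 2 - 9 / 4) * (4 / 7)) *
    Real.smoothTransition ((49 / 4 - ‖y‖ ^ 2) * (4 / 13))

theorem contDiff_annulusCutoff : ContDiff ℝ ∞ (annulusCutoff n) :=
  (Real.smoothTransition.contDiff.comp
    (((contDiff_norm_sq ℝ).sub contDiff_const).mul contDiff_const)).mul
  (Real.smoothTransition.contDiff.comp
    ((contDiff_const.sub (contDiff_norm_sq ℝ)).mul contDiff_const))

theorem annulusCutoff_eq_one {y : E} (h2 : 2 ≤ ‖y‖) (h3 : ‖y‖ ≤ 3) : annulusCutoff n y = 1 := by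
  rw [annulusCutoff, Real.smoothTransition.one_of_one_le (by nlinarith),
    Real.smoothTransition.one_of_one_le (by nlinarith), one_mul]

theorem tsupport_annulusCutoff_subset :
    tsupport (annulusCutoff n) ⊆ {y : E | ‖y‖ ∈ Icc (3 / 2 : ℝ) (7 / 2)} := by
  refine closure_minimal (fun y hy => ?_) (isClosed_Icc.preimage continuous_norm)
  by_contra h
  apply hy
  rw [mem_ofPred_eq, mem_Icc, not_and_or, not_le, not_le] at h
  rw [annulusCutoff]
  rcases h with h | h
  · rw [Real.smoothTransition.zero_of_nonpos, zero_mul]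
    nlinarith [norm_nonneg y]
  · rw [mul_comm, Real.smoothTransition.zero_of_nonpos, zero_mul]
    nlinarith [norm_nonneg y]

variable {𝕜 : Type*} [RCLike 𝕜]

/-- Pull back to the fixed annulus, cut off, apply the local Sobolev inequality and shift back.
Lebesgue measure and `dr dω` are compared only on the fixed annulus, so no power of `a` enters. -/
theorem exists_eLpNorm_cyl_le_smooth (hn : 0 < n) {k : ℕ} {s t : ℝ≥0∞} (hs1 : 1 ≤ s)
    (hS : LocalSobolev 𝕜 n k s t) :
    ∃ C : ℝ≥0, ∀ (a : ℝ), 0 ≤ a → ∀ f : smoothFun E 𝕜,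
      eLpNorm (f : E → 𝕜) t (cylMeasure n (Icc (a + 2) (a + 3)))
        ≤ C * ∑ μ ∈ yMultis n k,
          eLpNorm (yPow 𝕜 μ f : E → 𝕜) s (cylMeasure n (Icc (a + 3 / 2) (a + 7 / 2))) := by
  have hχ := contDiff_annulusCutoff (n := n)
  have hsupp := tsupport_annulusCutoff_subset (n := n)
  have hball : tsupport (annulusCutoff n) ⊆ Metric.closedBall (0 : E) 4 := fun y hy => by
    have := (hsupp hy).2
    rw [Metric.mem_closedBall, dist_zero_right]
    linarith
  have hc : HasCompactSupport (annulusCutoff n) :=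
    (isCompact_closedBall _ _).of_isClosed_subset (isClosed_tsupport _) hball
  have h0 : (0 : E) ∉ tsupport (annulusCutoff n) := fun h => by
    have := (hsupp h).1
    rw [norm_zero] at this
    linarith
  obtain ⟨C, hC⟩ := hS
  obtain ⟨D, hD, hDf⟩ := exists_norm_iteratedFDeriv_shift_le_sum (G := 𝕜) k hχ hc h0
  set c : ℝ≥0∞ := ENNReal.ofReal ((7 / 2 : ℝ) ^ (n - 1)) ^ (1 / s).toReal with hcdef
  have hct : c ≠ ⊤ := ENNReal.rpow_ne_top_of_nonneg (by positivity) ENNReal.ofReal_ne_top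
  refine ⟨C * (c.toNNReal * D.toNNReal), fun a ha f => ?_⟩
  have hpre : ∀ b d : ℝ, Icc b d = (· + a) ⁻¹' Icc (a + b) (a + d) := fun b d => by
    ext r
    simp only [mem_Icc, mem_preimage]
    constructor <;> rintro ⟨h1, h2⟩ <;> constructor <;> linarith
  have hfm : ∀ f : smoothFun E 𝕜, StronglyMeasurable (f : E → 𝕜) := fun f =>
    (contDiff_smoothFun f).continuous.stronglyMeasurable
  set g : E → 𝕜 := fun y => annulusCutoff n y • (f : E → 𝕜) (radialShift a y) with hg
  have hgs : ContDiff ℝ ∞ g := contDiff_smul_comp_radialShift hχ h0 a f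
  have hgt : tsupport g ⊆ tsupport (annulusCutoff n) := tsupport_smul_subset_left _ _
  set A : Set E := {y : E | ‖y‖ ∈ Icc (3 / 2 : ℝ) (7 / 2)} with hA
  have hJ0 : Icc (3 / 2 : ℝ) (7 / 2) ⊆ Ioi 0 := fun r hr => by
    have := hr.1
    rw [mem_Ioi]; linarith
  calc eLpNorm (f : E → 𝕜) t (cylMeasure n (Icc (a + 2) (a + 3)))
      = eLpNorm (fun y => (f : E → 𝕜) (radialShift a y)) t (cylMeasure n (Icc 2 3)) := by
        rw [hpre 2 3, eLpNorm_comp_radialShift a measurableSet_Icc (fun r hr => by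
          have := hr.1; linarith) (hfm f)]
    _ = eLpNorm g t (cylMeasure n (Icc 2 3)) := by
        refine eLpNorm_congr_ae ?_
        filter_upwards [ae_norm_mem_cylMeasure (n := n) (J := Icc (2 : ℝ) 3) measurableSet_Icc
          (fun r hr => by have := hr.1; rw [mem_Ioi]; linarith)] with y hy
        rw [hg]
        simp only [annulusCutoff_eq_one hy.1 hy.2, one_smul]
    _ ≤ eLpNorm g t volume := by
        refine eLpNorm_mono_measure _ ((cylMeasure_le_volume_restrict hn measurableSet_Icc
          fun r hr => ?_).trans Measure.restrict_le_self)
        have := hr.1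
        linarith
    _ ≤ C * eLpNorm (iteratedFDeriv ℝ k g) s volume := hC g hgs (hgt.trans hball)
    _ = C * eLpNorm (iteratedFDeriv ℝ k g) s (volume.restrict A) := by
        rw [eLpNorm_restrict_eq_of_support_subset]
        exact (support_iteratedFDeriv_subset k).trans (hgt.trans hsupp)
    _ ≤ C * eLpNorm (iteratedFDeriv ℝ k g) s
          (ENNReal.ofReal ((7 / 2 : ℝ) ^ (n - 1)) • cylMeasure n (Icc (3 / 2) (7 / 2))) := by
        refine mul_le_mul' le_rfl (eLpNorm_mono_measure _
          (volume_restrict_le_smul_cylMeasure hn measurableSet_Icc hJ0 fun r hr => hr.2))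
    _ = C * (c * eLpNorm (iteratedFDeriv ℝ k g) s (cylMeasure n (Icc (3 / 2) (7 / 2)))) := by
        rw [eLpNorm_smul_measure_of_ne_zero (by
          rw [ne_eq, ENNReal.ofReal_eq_zero, not_le]; positivity), smul_eq_mul]
    _ ≤ C * (c * (ENNReal.ofReal D * ∑ μ ∈ yMultis n k,
          eLpNorm (fun y => (yPow 𝕜 μ f : E → 𝕜) (radialShift a y)) s
            (cylMeasure n (Icc (3 / 2) (7 / 2))))) := by
        gcongr
        have hm : ∀ μ ∈ yMultis n k, AEStronglyMeasurable
            (fun y => ‖(yPow 𝕜 μ f : E → 𝕜) (radialShift a y)‖)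
            (cylMeasure n (Icc (3 / 2) (7 / 2))) := fun μ _ =>
          ((hfm _).comp_measurable (measurable_radialShift a)).norm.aestronglyMeasurable
        calc eLpNorm (iteratedFDeriv ℝ k g) s (cylMeasure n (Icc (3 / 2) (7 / 2)))
            ≤ ENNReal.ofReal D * eLpNorm (∑ μ ∈ yMultis n k,
                fun y => ‖(yPow 𝕜 μ f : E → 𝕜) (radialShift a y)‖) s
                (cylMeasure n (Icc (3 / 2) (7 / 2))) := by
              refine eLpNorm_le_mul_eLpNorm_of_ae_le_mul
                (Filter.Eventually.of_forall fun y => ?_) s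
              refine (hDf a f y).trans (le_of_eq ?_)
              rw [Finset.sum_apply, Real.norm_of_nonneg (Finset.sum_nonneg fun _ _ => norm_nonneg _)]
          _ ≤ _ := by
              gcongr
              refine (eLpNorm_sum_le hm hs1).trans (Finset.sum_le_sum fun μ _ => ?_)
              rw [eLpNorm_norm]
    _ = _ := by
        rw [ENNReal.coe_mul, ENNReal.coe_mul, ENNReal.coe_toNNReal hct, mul_assoc, mul_assoc]
        congr 3
        refine Finset.sum_congr rfl fun μ _ => ?_
        rw [hpre (3 / 2) (7 / 2), eLpNorm_comp_radialShift a measurableSet_Icc (fun r hr => by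
          have := hr.1; linarith) (hfm _)]

/-- The smooth estimate is applied to mollifications of radius at most `1/4`. Their fields on `[a +
3/2, a + 7/2]` see only the compact annulus with radii in `[a + 5/4, a + 15/4]`, which lies in `|x|
> R` because `R ≤ a + 1`. -/
theorem exists_eLpNorm_cyl_le_weak (hn : 0 < n) {k : ℕ} {s t : ℝ≥0∞} (hs1 : 1 ≤ s)
    (hst : s ≠ ⊤) (hS : LocalSobolev 𝕜 n k s t) :
    ∃ C : ℝ≥0, ∀ (R a : ℝ), 0 ≤ a → R ≤ a + 1 → ∀ (u : E → 𝕜) (v : YMulti n → E → 𝕜),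
      StronglyMeasurable u → (∀ μ, StronglyMeasurable (v μ)) →
      (∀ μ ∈ yMultis n k, HasWeakY {x | R < ‖x‖} μ u (v μ)) →
      eLpNorm u t (cylMeasure n (Icc (a + 2) (a + 3)))
        ≤ C * ∑ μ ∈ yMultis n k, eLpNorm (v μ) s (cylMeasure n (Ico (a + 1) (a + 4))) := by
  obtain ⟨C, hC⟩ := exists_eLpNorm_cyl_le_smooth hn hs1 hS
  set c : ℝ≥0∞ := ENNReal.ofReal ((4 : ℝ) ^ (n - 1)) ^ (1 / s).toReal with hcdef
  have hct : c ≠ ⊤ := ENNReal.rpow_ne_top_of_nonneg (by positivity) ENNReal.ofReal_ne_top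
  refine ⟨C * c.toNNReal, fun R a ha haR u v hu hv h => ?_⟩
  set K : Set E := {x : E | ‖x‖ ∈ Icc (a + 5 / 4) (a + 15 / 4)} with hKdef
  have hKm : MeasurableSet K := measurable_norm measurableSet_Icc
  have hKc : IsCompact K := by
    refine (isCompact_closedBall (0 : E) (a + 15 / 4)).of_isClosed_subset
      (isClosed_Icc.preimage continuous_norm) fun x hx => ?_
    rw [Metric.mem_closedBall, dist_zero_right]
    exact hx.2
  have hKU : K ⊆ {x | R < ‖x‖} := fun x hx => by
    have := hx.1
    rw [mem_ofPred_eq]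
    linarith
  have h0mem : (0 : YMulti n) ∈ yMultis n k := (mem_yMultis _).2 (by simp [yLen])
  have huI : Integrable (K.indicator u) :=
    (integrable_indicator_iff hKm).2 ((h 0 h0mem).locallyIntegrableOn_left.integrableOn_compact_subset
      hKU hKc)
  have huK : ∀ y ∉ K, K.indicator u y = 0 := fun y hy => indicator_of_notMem hy _
  set δ : ℕ → ℝ := fun j => 1 / 4 * (1 / ((j : ℝ) + 1)) with hδdef
  have hδ0 : ∀ j, 0 < δ j := fun j => by simp only [hδdef]; positivity
  have hδ4 : ∀ j, δ j ≤ 1 / 4 := fun j => by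
    simp only [hδdef]
    have : 1 / ((j : ℝ) + 1) ≤ 1 := by
      rw [div_le_one (by positivity)]
      linarith [(Nat.cast_nonneg j : (0 : ℝ) ≤ j)]
    linarith
  have hδlim : Filter.Tendsto δ Filter.atTop (nhds 0) := by
    have := (tendsto_one_div_add_atTop_nhds_zero_nat (𝕜 := ℝ)).const_mul (1 / 4 : ℝ)
    simpa [hδdef] using this
  set T : ℕ → smoothFun E 𝕜 := fun j => kernelInt huI hKc huK (mollKernel n (δ j)) with hT
  have hJ1 : ∀ b d : ℝ, a + 1 ≤ b → ∀ r ∈ Icc b d, 1 ≤ r := fun b d hb r hr => by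
    have := hr.1
    linarith
  have hbd : ∀ j, eLpNorm (T j : E → 𝕜) t (cylMeasure n (Icc (a + 2) (a + 3)))
      ≤ (C * c.toNNReal : ℝ≥0) *
        ∑ μ ∈ yMultis n k, eLpNorm (v μ) s (cylMeasure n (Ico (a + 1) (a + 4))) := by
    intro j
    refine (hC a ha (T j)).trans ?_
    rw [ENNReal.coe_mul, ENNReal.coe_toNNReal hct, mul_assoc]
    refine mul_le_mul' le_rfl ?_
    rw [Finset.mul_sum]
    refine Finset.sum_le_sum fun μ hμ => ?_
    have hball : ∀ x : E, ‖x‖ ∈ Icc (a + 3 / 2) (a + 7 / 2) → Metric.closedBall x (δ j) ⊆ K := by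
      intro x hx y hy
      rw [Metric.mem_closedBall, dist_eq_norm] at hy
      have h1 := abs_le.1 ((abs_norm_sub_norm_le y x).trans (hy.trans (hδ4 j)))
      have h2 := hx.1
      have h3 := hx.2
      constructor <;> linarith [h1.1, h1.2]
    calc eLpNorm (yPow 𝕜 μ (T j) : E → 𝕜) s (cylMeasure n (Icc (a + 3 / 2) (a + 7 / 2)))
        = eLpNorm (mollify (δ j) (v μ)) s (cylMeasure n (Icc (a + 3 / 2) (a + 7 / 2))) := by
          refine eLpNorm_congr_ae ?_
          filter_upwards [ae_norm_mem_cylMeasure (n := n) (J := Icc (a + 3 / 2) (a + 7 / 2))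
            measurableSet_Icc (fun r hr => by have := hr.1; rw [mem_Ioi]; linarith)] with x hx
          exact yPow_kernelInt_mollKernel (h μ hμ) hKc hKU huI huK (hδ0 j) (hball x hx)
      _ ≤ c * eLpNorm (v μ) s (cylMeasure n (Ico (a + 1) (a + 4))) := by
          have hb : 0 < a + 1 := by linarith
          set b : ℝ≥0∞ := ENNReal.ofReal ((a + 1) ^ (n - 1)) with hbdef
          have hb0 : b ≠ 0 := by rw [hbdef, ne_eq, ENNReal.ofReal_eq_zero, not_le]; positivity
          have hbt : b ≠ ⊤ := ENNReal.ofReal_ne_top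
          -- Mollification is bounded in Lebesgue measure, whose density lies between `(a +
          -- 1)^{n-1}` and `(a + 4)^{n-1}`. Their ratio is at most `4^{n-1}`, so the passage back to
          -- `dr dω` is uniform in `a`.
          have h4 : ENNReal.ofReal ((a + 4) ^ (n - 1)) ≤ ENNReal.ofReal ((4 : ℝ) ^ (n - 1)) * b := by
            rw [hbdef, ← ENNReal.ofReal_mul (by positivity), ← mul_pow]
            apply ENNReal.ofReal_le_ofReal
            gcongr
            linarith
          have h40 : ENNReal.ofReal ((4 : ℝ) ^ (n - 1)) * b ≠ 0 := by
            refine mul_ne_zero ?_ hb0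
            rw [ne_eq, ENNReal.ofReal_eq_zero, not_le]; positivity
          have hpos : b ^ (1 / s).toReal ≠ 0 := by
            simp [ENNReal.rpow_eq_zero_iff, hb0, hbt]
          have hfin : b ^ (1 / s).toReal ≠ ⊤ :=
            ENNReal.rpow_ne_top_of_nonneg (by positivity) hbt
          have key : b ^ (1 / s).toReal *
              eLpNorm (mollify (δ j) (v μ)) s (cylMeasure n (Icc (a + 3 / 2) (a + 7 / 2)))
              ≤ b ^ (1 / s).toReal *
                (c * eLpNorm (v μ) s (cylMeasure n (Ico (a + 1) (a + 4)))) := by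
            calc b ^ (1 / s).toReal *
                  eLpNorm (mollify (δ j) (v μ)) s (cylMeasure n (Icc (a + 3 / 2) (a + 7 / 2)))
                = eLpNorm (mollify (δ j) (v μ)) s
                    (b • cylMeasure n (Icc (a + 3 / 2) (a + 7 / 2))) := by
                  rw [eLpNorm_smul_measure_of_ne_zero hb0, smul_eq_mul]
              _ ≤ eLpNorm (mollify (δ j) (v μ)) s
                    (volume.restrict {x : E | ‖x‖ ∈ Icc (a + 3 / 2) (a + 7 / 2)}) :=
                  eLpNorm_mono_measure _ (smul_cylMeasure_le_volume_restrict hn measurableSet_Icc hb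
                    fun r hr => by have := hr.1; linarith)
              _ ≤ eLpNorm (v μ) s (volume.restrict K) :=
                  eLpNorm_mollify_le hs1 hst (hv μ) (hδ0 j) hKm
                    (measurable_norm measurableSet_Icc) hball
              _ ≤ eLpNorm (v μ) s ((ENNReal.ofReal ((4 : ℝ) ^ (n - 1)) * b) •
                    cylMeasure n (Ico (a + 1) (a + 4))) := by
                  refine eLpNorm_mono_measure _ ?_
                  refine (volume_restrict_le_smul_cylMeasure (c := a + 4) hn measurableSet_Icc
                    (fun r hr => by have := hr.1; rw [mem_Ioi]; linarith)
                    fun r hr => by have := hr.2; linarith).trans ?_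
                  refine Measure.le_iff.2 fun B hB => ?_
                  rw [Measure.smul_apply, Measure.smul_apply, smul_eq_mul, smul_eq_mul]
                  refine mul_le_mul' h4 (cylMeasure_mono (fun r hr => ?_) B)
                  exact ⟨by linarith [hr.1], by linarith [hr.2]⟩
              _ = _ := by
                  rw [eLpNorm_smul_measure_of_ne_zero h40, smul_eq_mul,
                    ENNReal.mul_rpow_of_nonneg _ _ (by positivity), hcdef]
                  ring
          exact (ENNReal.mul_le_mul_iff_right hpos hfin).1 key
  have hae : ∀ᵐ x ∂(cylMeasure n (Icc (a + 2) (a + 3))),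
      Filter.Tendsto (fun j => (T j : E → 𝕜) x) Filter.atTop (nhds (u x)) := by
    have h1 := ae_tendsto_mollify huI.locallyIntegrable hδ0 hδlim
    have hle : cylMeasure n (Icc (a + 2) (a + 3)) ≤ volume :=
      (cylMeasure_le_volume_restrict hn measurableSet_Icc
        (hJ1 _ _ (by linarith))).trans Measure.restrict_le_self
    filter_upwards [(Measure.absolutelyContinuous_of_le hle).ae_le h1,
      ae_norm_mem_cylMeasure (n := n) (J := Icc (a + 2) (a + 3)) measurableSet_Icc
        (fun r hr => by have := hr.1; rw [mem_Ioi]; linarith)] with x hx hxm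
    have hxK : x ∈ K := ⟨by linarith [hxm.1], by linarith [hxm.2]⟩
    rw [indicator_of_mem hxK] at hx
    exact hx
  -- Fatou's lemma, valid also for `t = ∞`, transfers the uniform bound to the limit.
  refine (Lp.eLpNorm_lim_le_liminf_eLpNorm (fun j =>
    (contDiff_smoothFun (T j)).continuous.stronglyMeasurable.aestronglyMeasurable) u hae).trans ?_
  exact Filter.liminf_le_of_le (by isBoundedDefault) fun b hb => by
    obtain ⟨j, hj⟩ := hb.exists
    exact hj.trans (hbd j)

end LocalEstimate

/-! ### Summing over radial intervals. -/

section Summation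

/-- Passing from estimates on unit intervals to an estimate on a half line. -/
theorem eLpNorm_Ici_le_of_intervals {ν : Measure ℝ} {f G : ℝ → ℝ≥0∞} {p q : ℝ≥0∞} (hp1 : 1 ≤ p)
    (hpq : p ≤ q) {C : ℝ≥0∞} {R : ℝ}
    (h : ∀ m : ℕ, eLpNorm f q (ν.restrict (Icc (R + m + 1) (R + m + 2)))
      ≤ C * eLpNorm G p (ν.restrict (Ico (R + m) (R + m + 3)))) :
    eLpNorm f q (ν.restrict (Ici (R + 1))) ≤ 3 * C * eLpNorm G p (ν.restrict (Ici R)) := by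
  have hp0 : p ≠ 0 := (zero_lt_one.trans_le hp1).ne'
  set B := eLpNorm G p (ν.restrict (Ici R)) with hB
  have hcover : Ici (R + 1) ⊆ ⋃ m : ℕ, Icc (R + m + 1) (R + m + 2) := fun r hr => by
    have hr0 : 0 ≤ r - (R + 1) := by
      have : R + 1 ≤ r := hr
      linarith
    have h1 := Nat.floor_le hr0
    have h2 := Nat.lt_floor_add_one (r - (R + 1))
    exact mem_iUnion.2 ⟨⌊r - (R + 1)⌋₊, by linarith, by linarith⟩
  have hJ : ∀ m : ℕ, Ico (R + m) (R + m + 3) ⊆ Ici R := fun m r hr => by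
    have h1 := hr.1
    have h2 : (0 : ℝ) ≤ m := Nat.cast_nonneg m
    rw [mem_Ici]; linarith
  have hmB : ∀ m : ℕ, eLpNorm G p (ν.restrict (Ico (R + m) (R + m + 3))) ≤ B := fun m =>
    eLpNorm_mono_measure _ (Measure.restrict_mono (hJ m) le_rfl)
  have h3 : C * B ≤ 3 * C * B := by
    rw [mul_assoc]
    exact le_mul_of_one_le_left' (by norm_num)
  rcases eq_or_ne q ⊤ with rfl | hq
  · refine le_trans ?_ h3
    rw [eLpNorm_exponent_top]
    refine essSup_le_of_ae_le _ ?_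
    refine Filter.Eventually.filter_mono (ae_mono (Measure.restrict_mono hcover le_rfl)) ?_
    refine (ae_restrict_iUnion_iff _ _).2 fun m => ?_
    have h4 := (h m).trans (mul_le_mul' le_rfl (hmB m))
    rw [eLpNorm_exponent_top] at h4
    exact (enorm_ae_le_eLpNormEssSup f _).mono fun r hr => hr.trans h4
  · have hp : p ≠ ⊤ := ne_top_of_le_ne_top hq hpq
    have hq0 : q ≠ 0 := fun h => hp0 (le_antisymm (h ▸ hpq) zero_le)
    have hpr : 0 < p.toReal := ENNReal.toReal_pos hp0 hp
    have hqr : 0 < q.toReal := ENNReal.toReal_pos hq0 hq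
    have hpqr : 0 ≤ q.toReal - p.toReal := sub_nonneg.2 (ENNReal.toReal_mono hq hpq)
    have hpow : ∀ (q : ℝ≥0∞) (f : ℝ → ℝ≥0∞) (μ : Measure ℝ), q ≠ 0 → q ≠ ⊤ →
        eLpNorm f q μ ^ q.toReal = ∫⁻ r, f r ^ q.toReal ∂μ := fun q f μ h0 ht => by
      rw [eLpNorm_eq_lintegral_rpow_enorm_toReal h0 ht, ← ENNReal.rpow_mul, one_div,
        inv_mul_cancel₀ (ENNReal.toReal_pos h0 ht).ne', ENNReal.rpow_one]
      simp
    set F : ℝ → ℝ≥0∞ := fun r => G r ^ p.toReal with hF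
    set D : ℕ → Set ℝ := fun m => Ico (R + m) (R + m + 1) with hD
    have hDs : ∑' m, ∫⁻ r in D m, F r ∂ν ≤ B ^ p.toReal := by
      rw [hB, hpow p G _ hp0 hp, ← lintegral_iUnion (fun m => measurableSet_Ico)]
      · refine lintegral_mono_set (iUnion_subset fun m r hr => hJ m ⟨hr.1, ?_⟩)
        linarith [hr.2]
      · intro i j hij
        refine Set.disjoint_left.2 fun r hi hj => hij ?_
        have h1 : (i : ℝ) < j + 1 := by linarith [hi.1, hj.2]
        have h2 : (j : ℝ) < i + 1 := by linarith [hi.2, hj.1]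
        have h1' : i < j + 1 := by exact_mod_cast h1
        have h2' : j < i + 1 := by exact_mod_cast h2
        omega
    -- The overlapping intervals of length 3 split into three families of disjoint unit intervals;
    -- this is the origin of the factor 3.
    have hsplit : ∀ m : ℕ, ∫⁻ r in Ico (R + m) (R + m + 3), F r ∂ν
        ≤ ∫⁻ r in D m, F r ∂ν + ∫⁻ r in D (m + 1), F r ∂ν + ∫⁻ r in D (m + 2), F r ∂ν := by
      intro m
      have hsub : Ico (R + m) (R + m + 3) ⊆ (D m ∪ D (m + 1)) ∪ D (m + 2) := fun r hr => by
        have h1 := hr.1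
        have h2 := hr.2
        simp only [hD, mem_union, mem_Ico]
        push_cast
        by_cases hr1 : r < R + m + 1
        · exact Or.inl (Or.inl ⟨h1, hr1⟩)
        · by_cases hr2 : r < R + m + 2
          · exact Or.inl (Or.inr ⟨by linarith, by linarith⟩)
          · exact Or.inr ⟨by linarith, by linarith⟩
      refine (lintegral_mono_set hsub).trans ((lintegral_union_le _ _ _).trans ?_)
      gcongr
      exact lintegral_union_le _ _ _
    have hsum : ∑' m : ℕ, ∫⁻ r in Ico (R + m) (R + m + 3), F r ∂ν ≤ 3 * B ^ p.toReal := by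
      refine (ENNReal.tsum_le_tsum hsplit).trans ?_
      rw [ENNReal.tsum_add, ENNReal.tsum_add]
      have hs1 : ∑' m : ℕ, ∫⁻ r in D (m + 1), F r ∂ν ≤ B ^ p.toReal :=
        (ENNReal.tsum_comp_le_tsum_of_injective (add_left_injective 1)
          (fun m => ∫⁻ r in D m, F r ∂ν)).trans hDs
      have hs2 : ∑' m : ℕ, ∫⁻ r in D (m + 2), F r ∂ν ≤ B ^ p.toReal :=
        (ENNReal.tsum_comp_le_tsum_of_injective (add_left_injective 2)
          (fun m => ∫⁻ r in D m, F r ∂ν)).trans hDs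
      calc _ ≤ B ^ p.toReal + B ^ p.toReal + B ^ p.toReal := add_le_add (add_le_add hDs hs1) hs2
        _ = 3 * B ^ p.toReal := by ring
    have hfin : eLpNorm f q (ν.restrict (Ici (R + 1))) ^ q.toReal
        ≤ (3 * C * B) ^ q.toReal := by
      rw [hpow q f _ hq0 hq]
      calc ∫⁻ r in Ici (R + 1), f r ^ q.toReal ∂ν
          ≤ ∫⁻ r in ⋃ m : ℕ, Icc (R + m + 1) (R + m + 2), f r ^ q.toReal ∂ν :=
            lintegral_mono_set hcover
        _ ≤ ∑' m : ℕ, ∫⁻ r in Icc (R + m + 1) (R + m + 2), f r ^ q.toReal ∂ν :=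
            lintegral_iUnion_le _ _
        _ ≤ ∑' m : ℕ, C ^ q.toReal * B ^ (q.toReal - p.toReal) *
              ∫⁻ r in Ico (R + m) (R + m + 3), F r ∂ν := by
            refine ENNReal.tsum_le_tsum fun m => ?_
            rw [← hpow q f _ hq0 hq, ← hpow p G _ hp0 hp]
            refine (ENNReal.rpow_le_rpow (h m) hqr.le).trans ?_
            rw [ENNReal.mul_rpow_of_nonneg _ _ hqr.le, mul_assoc]
            gcongr
            -- The embedding `ℓ^p ⊆ ℓ^q`: the excess power `q - p` is bounded by the full norm `B`,
            -- leaving summable `p`-th powers.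
            calc eLpNorm G p (ν.restrict (Ico (R + m) (R + m + 3))) ^ q.toReal
                = eLpNorm G p (ν.restrict (Ico (R + m) (R + m + 3))) ^ (q.toReal - p.toReal) *
                  eLpNorm G p (ν.restrict (Ico (R + m) (R + m + 3))) ^ p.toReal := by
                  rw [← ENNReal.rpow_add_of_nonneg _ _ hpqr hpr.le, sub_add_cancel]
              _ ≤ _ := by
                  gcongr
                  exact hmB m
        _ = C ^ q.toReal * B ^ (q.toReal - p.toReal) *
              ∑' m : ℕ, ∫⁻ r in Ico (R + m) (R + m + 3), F r ∂ν := ENNReal.tsum_mul_left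
        _ ≤ C ^ q.toReal * B ^ (q.toReal - p.toReal) * (3 * B ^ p.toReal) := by gcongr
        _ = 3 * (C * B) ^ q.toReal := by
            rw [ENNReal.mul_rpow_of_nonneg _ _ hqr.le]
            have : B ^ q.toReal = B ^ (q.toReal - p.toReal) * B ^ p.toReal := by
              rw [← ENNReal.rpow_add_of_nonneg _ _ hpqr hpr.le, sub_add_cancel]
            rw [this]
            ring
        _ ≤ 3 ^ q.toReal * (C * B) ^ q.toReal := by
            gcongr
            have h1q : 1 ≤ q.toReal := by
              rw [← ENNReal.toReal_one]
              exact ENNReal.toReal_mono hq (hp1.trans hpq)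
            simpa using ENNReal.rpow_le_rpow_of_exponent_le (x := 3) (by norm_num) h1q
        _ = (3 * C * B) ^ q.toReal := by
            rw [mul_assoc, ENNReal.mul_rpow_of_nonneg 3 _ hqr.le]
    exact (ENNReal.rpow_le_rpow_iff hqr).1 hfin

end Summation

/-! ### Norms on spheres and freezing of the radial weights. -/

section SphereNorm

variable {n : ℕ}

local notation "E" => EuclideanSpace ℝ (Fin n)
local notation "S" => Metric.sphere (0 : EuclideanSpace ℝ (Fin n)) 1
local notation "σ" => Measure.toSphere (volume : Measure (EuclideanSpace ℝ (Fin n)))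

variable {𝕜 : Type*} [RCLike 𝕜]

/-- The norm `‖f(r ·)‖_{L^s(S^{n-1})}`. -/
def sphereNorm (s : ℝ≥0∞) (f : EuclideanSpace ℝ (Fin n) → 𝕜) (r : ℝ) : ℝ≥0∞ :=
  eLpNorm (fun θ : S => f (r • (θ : E))) s σ

variable (n) in
/-- The measure `r^{n-1} dr`. -/
def powMeasure : Measure ℝ := volume.withDensity fun r => ENNReal.ofReal (r ^ (n - 1))

theorem powMeasure_restrict {J : Set ℝ} (hJ : MeasurableSet J) : (powMeasure n).restrict J =
    (volume.restrict J).withDensity fun r => ENNReal.ofReal (r ^ (n - 1)) :=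
  restrict_withDensity hJ _

theorem mixedNorm_eq (q s : ℝ≥0∞) (R : ℝ) (f : E → 𝕜) :
    mixedNorm q s R f = eLpNorm (sphereNorm s f) q ((powMeasure n).restrict (Ici R)) := by
  rw [powMeasure_restrict measurableSet_Ici]
  rfl

theorem measurable_sphereNorm {s : ℝ≥0∞} (hs0 : s ≠ 0) (hst : s ≠ ⊤) {f : E → 𝕜}
    (hf : StronglyMeasurable f) : Measurable (sphereNorm s f) := by
  have h : sphereNorm s f
      = fun r => (∫⁻ θ : S, ‖f (r • (θ : E))‖ₑ ^ s.toReal ∂σ) ^ (1 / s.toReal) := by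
    funext r
    exact eLpNorm_eq_lintegral_rpow_enorm_toReal hs0 hst
  rw [h]
  have hF : Measurable fun p : ℝ × S => ‖f (p.1 • (p.2 : E))‖ₑ ^ s.toReal :=
    (hf.enorm.comp measurable_smul_sphere).pow_const _
  exact hF.lintegral_prod_right'.pow_const _

theorem eLpNorm_cylMeasure_eq {s : ℝ≥0∞} (hs0 : s ≠ 0) (hst : s ≠ ⊤) {f : E → 𝕜}
    (hf : StronglyMeasurable f) (J : Set ℝ) :
    eLpNorm f s (cylMeasure n J) = eLpNorm (sphereNorm s f) s (volume.restrict J) := by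
  rw [eLpNorm_eq_lintegral_rpow_enorm_toReal hs0 hst, eLpNorm_eq_lintegral_rpow_enorm_toReal hs0 hst,
    lintegral_cylMeasure J (hf.enorm.pow_const _)]
  congr 1
  refine lintegral_congr fun r => ?_
  rw [sphereNorm, eLpNorm_eq_lintegral_rpow_enorm_toReal hs0 hst, enorm_eq_self, ← ENNReal.rpow_mul,
    one_div, inv_mul_cancel₀ (ENNReal.toReal_pos hs0 hst).ne', ENNReal.rpow_one]

theorem ae_ae_of_ae_cylMeasure {J : Set ℝ} {P : E → Prop} (h : ∀ᵐ x ∂(cylMeasure n J), P x) :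
    ∀ᵐ r ∂(volume.restrict J), ∀ᵐ θ : S ∂σ, P (r • (θ : E)) :=
  Measure.ae_ae_of_ae_prod (ae_of_ae_map measurable_smul_sphere.aemeasurable h)

/-- Hölder's inequality on an interval of length one. For `t = ∞` the bound passes through null sets
and Fubini, so measurability of the supremum norm in `r` is not needed. -/
theorem eLpNorm_sphereNorm_le {q t : ℝ≥0∞} (ht0 : t ≠ 0) (hqt : q ≤ t) {f : E → 𝕜}
    (hf : StronglyMeasurable f) {J : Set ℝ} (hJ : volume J = 1) :
    eLpNorm (sphereNorm t f) q (volume.restrict J) ≤ eLpNorm f t (cylMeasure n J) := by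
  have : IsProbabilityMeasure (volume.restrict J) := ⟨by rw [Measure.restrict_apply_univ, hJ]⟩
  rcases eq_or_ne t ⊤ with rfl | htt
  · have h := ae_ae_of_ae_cylMeasure (enorm_ae_le_eLpNormEssSup f (cylMeasure n J))
    rw [eLpNorm_exponent_top]
    have h2 : ∀ᵐ r ∂(volume.restrict J),
        ‖sphereNorm ⊤ f r‖ₑ ≤ eLpNormEssSup f (cylMeasure n J) := by
      filter_upwards [h] with r hr
      rw [enorm_eq_self, sphereNorm, eLpNorm_exponent_top]
      exact eLpNormEssSup_le_of_ae_enorm_bound hr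
    refine (eLpNorm_le_of_ae_enorm_bound h2).trans (le_of_eq ?_)
    rw [measure_univ, ENNReal.one_rpow, smul_eq_mul, mul_one]
  · rw [eLpNorm_cylMeasure_eq ht0 htt hf]
    exact eLpNorm_le_eLpNorm_of_exponent_le hqt
      (measurable_sphereNorm ht0 htt hf).aestronglyMeasurable

theorem eLpNorm_cylMeasure_le {s p : ℝ≥0∞} (hs1 : 1 ≤ s) (hst : s ≠ ⊤) (hsp : s ≤ p) {f : E → 𝕜}
    (hf : StronglyMeasurable f) {J : Set ℝ} (hJ : volume J = 3) :
    eLpNorm f s (cylMeasure n J) ≤ 3 * eLpNorm (sphereNorm s f) p (volume.restrict J) := by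
  have hs0 : s ≠ 0 := (zero_lt_one.trans_le hs1).ne'
  rw [eLpNorm_cylMeasure_eq hs0 hst hf, mul_comm]
  refine (eLpNorm_le_eLpNorm_mul_rpow_measure_univ hsp
    (measurable_sphereNorm hs0 hst hf).aestronglyMeasurable).trans ?_
  gcongr
  rw [Measure.restrict_apply_univ, hJ]
  have h1 : 1 / s.toReal - 1 / p.toReal ≤ 1 := by
    have h2 : 1 / s.toReal ≤ 1 := by
      rw [div_le_one (ENNReal.toReal_pos hs0 hst), ← ENNReal.toReal_one]
      exact ENNReal.toReal_mono hst hs1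
    have h3 : 0 ≤ 1 / p.toReal := by positivity
    linarith
  simpa using ENNReal.rpow_le_rpow_of_exponent_le (x := 3) (by norm_num) h1

theorem sphereNorm_rWeight (s : ℝ≥0∞) (γ : ℝ) (f : E → 𝕜) {r : ℝ} (hr : 0 < r) :
    sphereNorm s (rWeight γ f) r = ENNReal.ofReal (r ^ γ) * sphereNorm s f r := by
  have h : (fun θ : S => rWeight γ f (r • (θ : E))) = (r ^ γ : ℝ) • fun θ : S => f (r • (θ : E)) := by
    funext θ
    simp only [rWeight, Pi.smul_apply]
    rw [norm_smul, norm_eq_of_mem_sphere, mul_one, Real.norm_of_nonneg hr.le]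
  rw [sphereNorm, h, eLpNorm_const_smul, Real.enorm_of_nonneg (by positivity)]
  rfl

/-- The ratio `r / b` lies in `[1, 4]`, and `|γ|` serves both signs of the exponent. -/
theorem rpow_le_four_rpow_mul {b r : ℝ} (hb : 0 < b) (hbr : b ≤ r) (hr : r ≤ 4 * b) (γ : ℝ) :
    r ^ γ ≤ 4 ^ |γ| * b ^ γ ∧ b ^ γ ≤ 4 ^ |γ| * r ^ γ := by
  have hr0 : 0 < r := hb.trans_le hbr
  have h1 : 1 ≤ r / b := (one_le_div hb).2 hbr
  have h4 : r / b ≤ 4 := (div_le_iff₀ hb).2 hr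
  have hup : (r / b) ^ γ ≤ 4 ^ |γ| :=
    (Real.rpow_le_rpow_of_exponent_le h1 (le_abs_self γ)).trans
      (Real.rpow_le_rpow (by positivity) h4 (abs_nonneg γ))
  have hlo : (r / b) ^ (-γ) ≤ 4 ^ |γ| :=
    (Real.rpow_le_rpow_of_exponent_le h1 (neg_le_abs γ)).trans
      (Real.rpow_le_rpow (by positivity) h4 (abs_nonneg γ))
  constructor
  · rwa [Real.div_rpow hr0.le hb.le, div_le_iff₀ (by positivity)] at hup
  · rw [Real.rpow_neg (by positivity), Real.div_rpow hr0.le hb.le, inv_div,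
      div_le_iff₀ (by positivity)] at hlo
    exact hlo

theorem withDensity_le_smul {μ : Measure ℝ} {w : ℝ → ℝ≥0∞} {c : ℝ≥0∞} (h : ∀ᵐ r ∂μ, w r ≤ c) :
    μ.withDensity w ≤ c • μ := by
  rw [← withDensity_const]
  exact withDensity_mono h

theorem smul_le_withDensity {μ : Measure ℝ} {w : ℝ → ℝ≥0∞} {c : ℝ≥0∞} (h : ∀ᵐ r ∂μ, c ≤ w r) :
    c • μ ≤ μ.withDensity w := by
  rw [← withDensity_const]
  exact withDensity_mono h

theorem ofReal_pow_rpow (hn : 0 < n) {b : ℝ} (hb : 0 < b) {e : ℝ} :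
    ENNReal.ofReal (b ^ (n - 1)) ^ e = ENNReal.ofReal (b ^ (((n : ℝ) - 1) * e)) := by
  rw [ENNReal.ofReal_rpow_of_pos (by positivity), ← Real.rpow_natCast, ← Real.rpow_mul hb.le,
    Nat.cast_pred hn]

/-- Freezing the weight at `b` yields `b^β` from `r^β` and `b^{(n-1)/q}` from the density `r^{n-1}`,
the latter being `1` when `q = ∞`. `mul_eLpNorm_le_eLpNorm_powMeasure` is the reverse comparison for
the right-hand side. -/
theorem eLpNorm_powMeasure_le (hn : 0 < n) (q t : ℝ≥0∞) (β : ℝ) (u : E → 𝕜) {b : ℝ} (hb : 0 < b)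
    {I : Set ℝ} (hI : MeasurableSet I) (hIb : I ⊆ Icc b (4 * b)) :
    eLpNorm (sphereNorm t (rWeight β u)) q ((powMeasure n).restrict I)
      ≤ ENNReal.ofReal (4 ^ |β| * 4 ^ (((n : ℝ) - 1) * (q⁻¹).toReal)) *
        (ENNReal.ofReal (b ^ (β + ((n : ℝ) - 1) * (q⁻¹).toReal)) *
          eLpNorm (sphereNorm t u) q (volume.restrict I)) := by
  set c : ℝ≥0∞ := ENNReal.ofReal ((4 * b) ^ (n - 1)) with hc
  have hc0 : c ≠ 0 := by rw [hc, ne_eq, ENNReal.ofReal_eq_zero, not_le]; positivity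
  have hmeas : (powMeasure n).restrict I ≤ c • volume.restrict I := by
    rw [powMeasure_restrict hI]
    refine withDensity_le_smul ((ae_restrict_mem hI).mono fun r hr => ENNReal.ofReal_le_ofReal ?_)
    have h1 := hIb hr
    have h0 : 0 ≤ r := hb.le.trans h1.1
    gcongr
    exact h1.2
  have hpt : ∀ᵐ r ∂(volume.restrict I), ‖sphereNorm t (rWeight β u) r‖ₑ
      ≤ ENNReal.ofReal (4 ^ |β| * b ^ β) * ‖sphereNorm t u r‖ₑ := by
    refine (ae_restrict_mem hI).mono fun r hr => ?_
    have h1 := hIb hr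
    rw [enorm_eq_self, enorm_eq_self, sphereNorm_rWeight t β u (hb.trans_le h1.1)]
    gcongr
    exact (rpow_le_four_rpow_mul hb h1.1 h1.2 β).1
  calc eLpNorm (sphereNorm t (rWeight β u)) q ((powMeasure n).restrict I)
      ≤ eLpNorm (sphereNorm t (rWeight β u)) q (c • volume.restrict I) :=
        eLpNorm_mono_measure _ hmeas
    _ = c ^ (1 / q).toReal * eLpNorm (sphereNorm t (rWeight β u)) q (volume.restrict I) := by
        rw [eLpNorm_smul_measure_of_ne_zero hc0, smul_eq_mul]
    _ ≤ c ^ (1 / q).toReal * (ENNReal.ofReal (4 ^ |β| * b ^ β) *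
          eLpNorm (sphereNorm t u) q (volume.restrict I)) := by
        gcongr
        exact eLpNorm_le_mul_eLpNorm_of_ae_le_mul' (c := Real.toNNReal _) hpt _
    _ = _ := by
        rw [hc, ofReal_pow_rpow hn (by positivity), one_div, ← mul_assoc, ← mul_assoc,
          ← ENNReal.ofReal_mul (by positivity), ← ENNReal.ofReal_mul (by positivity),
          Real.mul_rpow (by norm_num) hb.le, Real.rpow_add hb]
        congr 2
        ring

theorem mul_eLpNorm_le_eLpNorm_powMeasure (hn : 0 < n) (p s : ℝ≥0∞) (γ : ℝ) (v : E → 𝕜) {b : ℝ}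
    (hb : 0 < b) {J : Set ℝ} (hJ : MeasurableSet J) (hJb : J ⊆ Icc b (4 * b)) :
    ENNReal.ofReal (b ^ (γ + ((n : ℝ) - 1) * (p⁻¹).toReal)) *
        eLpNorm (sphereNorm s v) p (volume.restrict J)
      ≤ ENNReal.ofReal (4 ^ |γ|) *
        eLpNorm (sphereNorm s (rWeight γ v)) p ((powMeasure n).restrict J) := by
  set c : ℝ≥0∞ := ENNReal.ofReal (b ^ (n - 1)) with hc
  have hc0 : c ≠ 0 := by rw [hc, ne_eq, ENNReal.ofReal_eq_zero, not_le]; positivity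
  have hmeas : c • volume.restrict J ≤ (powMeasure n).restrict J := by
    rw [powMeasure_restrict hJ]
    refine smul_le_withDensity ((ae_restrict_mem hJ).mono fun r hr => ENNReal.ofReal_le_ofReal ?_)
    gcongr
    exact (hJb hr).1
  have hpt : ∀ᵐ r ∂(volume.restrict J), ‖sphereNorm s v r‖ₑ
      ≤ ENNReal.ofReal (4 ^ |γ| * b ^ (-γ)) * ‖sphereNorm s (rWeight γ v) r‖ₑ := by
    refine (ae_restrict_mem hJ).mono fun r hr => ?_
    have h1 := hJb hr
    have hr0 : 0 < r := hb.trans_le h1.1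
    rw [enorm_eq_self, enorm_eq_self, sphereNorm_rWeight s γ v hr0, ← mul_assoc,
      ← ENNReal.ofReal_mul (by positivity)]
    refine le_mul_of_one_le_left' ?_
    rw [← ENNReal.ofReal_one]
    apply ENNReal.ofReal_le_ofReal
    have h2 := (rpow_le_four_rpow_mul hb h1.1 h1.2 γ).2
    rw [Real.rpow_neg hb.le]
    have h3 : 0 < b ^ γ := by positivity
    calc (1 : ℝ) = b ^ γ * (b ^ γ)⁻¹ := (mul_inv_cancel₀ h3.ne').symm
      _ ≤ (4 ^ |γ| * r ^ γ) * (b ^ γ)⁻¹ := by gcongr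
      _ = _ := by ring
  calc ENNReal.ofReal (b ^ (γ + ((n : ℝ) - 1) * (p⁻¹).toReal)) *
        eLpNorm (sphereNorm s v) p (volume.restrict J)
      ≤ ENNReal.ofReal (b ^ (γ + ((n : ℝ) - 1) * (p⁻¹).toReal)) *
        (ENNReal.ofReal (4 ^ |γ| * b ^ (-γ)) *
          eLpNorm (sphereNorm s (rWeight γ v)) p (volume.restrict J)) := by
        gcongr
        exact eLpNorm_le_mul_eLpNorm_of_ae_le_mul' (c := Real.toNNReal _) hpt _
    _ = ENNReal.ofReal (4 ^ |γ|) * (c ^ (1 / p).toReal *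
          eLpNorm (sphereNorm s (rWeight γ v)) p (volume.restrict J)) := by
        rw [hc, ofReal_pow_rpow hn hb, one_div, ← mul_assoc, ← mul_assoc,
          ← ENNReal.ofReal_mul (by positivity), ← ENNReal.ofReal_mul (by positivity),
          Real.rpow_add hb, Real.rpow_neg hb.le]
        congr 2
        have h3 : b ^ γ ≠ 0 := by positivity
        field_simp
    _ = ENNReal.ofReal (4 ^ |γ|) *
          eLpNorm (sphereNorm s (rWeight γ v)) p (c • volume.restrict J) := by
        rw [eLpNorm_smul_measure_of_ne_zero hc0, smul_eq_mul]
    _ ≤ _ := mul_le_mul' le_rfl (eLpNorm_mono_measure _ hmeas)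

end SphereNorm

/-! ### The weighted estimate from a local Sobolev inequality. -/

section Estimate

variable {n : ℕ}

local notation "E" => EuclideanSpace ℝ (Fin n)
local notation "S" => Metric.sphere (0 : EuclideanSpace ℝ (Fin n)) 1
local notation "σ" => Measure.toSphere (volume : Measure (EuclideanSpace ℝ (Fin n)))

variable {𝕜 : Type*} [RCLike 𝕜]

theorem yRev_eq_zero_of_notMem_tsupport (μ : YMulti n) {φ : E → ℝ} (hφ : ContDiff ℝ ∞ φ) {x : E}
    (hx : x ∉ tsupport φ) : yRev μ φ x = 0 := by
  have h := coe_yEnd_reverse μ ⟨φ, hφ⟩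
  rw [← h]
  exact image_eq_zero_of_notMem_tsupport fun h' => hx (tsupport_yEnd_prod_subset _ _ h')

/-- A weak derivative depends only on the almost everywhere classes of the functions. -/
theorem HasWeakY.congr {U : Set E} (hU : MeasurableSet U) {μ : YMulti n} {u v u' v' : E → 𝕜}
    (h : HasWeakY U μ u v) (hu : u =ᵐ[volume.restrict U] u') (hv : v =ᵐ[volume.restrict U] v') :
    HasWeakY U μ u' v' where
  locallyIntegrableOn_left := h.locallyIntegrableOn_left.congr hu
  locallyIntegrableOn_right := h.locallyIntegrableOn_right.congr hv
  integral_eq φ hφ hc hs := by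
    have hu1 : ∫ x, yRev μ φ x • u x = ∫ x, yRev μ φ x • u' x := by
      refine integral_congr_ae ?_
      filter_upwards [(ae_restrict_iff' hU).1 hu] with x hx
      by_cases hxs : x ∈ tsupport φ
      · rw [hx (hs hxs)]
      · simp only [yRev_eq_zero_of_notMem_tsupport μ hφ hxs, zero_smul]
    have hv1 : ∫ x, φ x • v x = ∫ x, φ x • v' x := by
      refine integral_congr_ae ?_
      filter_upwards [(ae_restrict_iff' hU).1 hv] with x hx
      by_cases hxs : x ∈ tsupport φ
      · rw [hx (hs hxs)]
      · simp only [image_eq_zero_of_notMem_tsupport hxs, zero_smul]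
    rw [← hu1, ← hv1]
    exact h.integral_eq φ hφ hc hs

/-- Lebesgue null sets in `|x| > R` are null for `dr dω`, so the functions agree almost everywhere
on almost every sphere. The endpoint `r = R`, where nothing is known, is a single radius and hence
null. -/
theorem eLpNorm_sphereNorm_congr (hn : 0 < n) {R R' : ℝ} (hR : 1 ≤ R) (hR' : R ≤ R') {f g : E → 𝕜}
    (h : f =ᵐ[volume.restrict {x | R < ‖x‖}] g) (q s : ℝ≥0∞) (γ : ℝ) :
    eLpNorm (sphereNorm s (rWeight γ f)) q ((powMeasure n).restrict (Ici R'))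
      = eLpNorm (sphereNorm s (rWeight γ g)) q ((powMeasure n).restrict (Ici R')) := by
  have h1 : ∀ᵐ x ∂(cylMeasure n (Ioi R)), f x = g x :=
    Filter.Eventually.filter_mono (ae_mono (cylMeasure_le_volume_restrict hn measurableSet_Ioi
      fun r hr => hR.trans (le_of_lt hr))) h
  have h2 := ae_ae_of_ae_cylMeasure h1
  have h3 : ∀ᵐ r ∂(volume.restrict (Ici R')),
      sphereNorm s (rWeight γ f) r = sphereNorm s (rWeight γ g) r := by
    have hle : volume.restrict (Ici R') ≤ volume.restrict (Ioi R) := by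
      rw [Measure.restrict_congr_set Ioi_ae_eq_Ici.symm]
      exact Measure.restrict_mono (Ioi_subset_Ioi hR') le_rfl
    filter_upwards [Filter.Eventually.filter_mono (ae_mono hle) h2] with r hr
    refine eLpNorm_congr_ae ?_
    filter_upwards [hr] with θ hθ
    simp only [rWeight, hθ]
  refine eLpNorm_congr_ae ?_
  rw [powMeasure_restrict measurableSet_Ici]
  exact (withDensity_absolutelyContinuous _ _).ae_le h3

theorem stronglyMeasurable_rWeight (γ : ℝ) {f : E → 𝕜} (hf : StronglyMeasurable f) :
    StronglyMeasurable (rWeight γ f) := by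
  have h : Measurable fun x : E => ‖x‖ ^ γ := measurable_norm.pow_const γ
  exact h.stronglyMeasurable.smul hf

/-- The estimate for representatives which are measurable everywhere. -/
theorem exists_mixedNorm_le_of_stronglyMeasurable (hn : 0 < n) {k : ℕ} {s t p q : ℝ≥0∞}
    (hs1 : 1 ≤ s) (hst : s ≠ ⊤) (hsp : s ≤ p) (hpq : p ≤ q) (hqt : q ≤ t)
    (hS : LocalSobolev 𝕜 n k s t) (β : ℝ) :
    ∃ C : ℝ≥0, ∀ R : ℝ, 3 ≤ R → ∀ (u : E → 𝕜) (v : YMulti n → E → 𝕜),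
      StronglyMeasurable u → (∀ μ, StronglyMeasurable (v μ)) →
      (∀ μ ∈ yMultis n k, HasWeakY {x | R < ‖x‖} μ u (v μ)) →
      mixedNorm q t (R + 1) (rWeight β u) ≤
        C * ∑ μ ∈ yMultis n k, mixedNorm p s R
          (rWeight (β - ((n : ℝ) - 1) * (p⁻¹).toReal + ((n : ℝ) - 1) * (q⁻¹).toReal) (v μ)) := by
  obtain ⟨C, hC⟩ := exists_eLpNorm_cyl_le_weak hn hs1 hst hS
  set γ : ℝ := β - ((n : ℝ) - 1) * (p⁻¹).toReal + ((n : ℝ) - 1) * (q⁻¹).toReal with hγ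
  have hs0 : s ≠ 0 := (zero_lt_one.trans_le hs1).ne'
  have hp1 : 1 ≤ p := hs1.trans hsp
  have ht0 : t ≠ 0 := (zero_lt_one.trans_le (hp1.trans (hpq.trans hqt))).ne'
  set A : ℝ≥0 := Real.toNNReal (4 ^ |β| * 4 ^ (((n : ℝ) - 1) * (q⁻¹).toReal)) with hA
  set B : ℝ≥0 := Real.toNNReal (4 ^ |γ|) with hB
  refine ⟨3 * (A * C * (yMultis n k).card * 3 * B), fun R hR u v hu hv hw => ?_⟩
  set g : YMulti n → ℝ → ℝ≥0∞ := fun μ => sphereNorm s (rWeight γ (v μ)) with hg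
  have hgm : ∀ μ, Measurable (g μ) := fun μ =>
    measurable_sphereNorm hs0 hst (stronglyMeasurable_rWeight γ (hv μ))
  simp only [mixedNorm_eq]
  have key : ∀ m : ℕ, eLpNorm (sphereNorm t (rWeight β u)) q
      ((powMeasure n).restrict (Icc (R + m + 1) (R + m + 2)))
      ≤ (A * C * (yMultis n k).card * 3 * B : ℝ≥0) * eLpNorm (∑ μ ∈ yMultis n k, g μ) p
        ((powMeasure n).restrict (Ico (R + m) (R + m + 3))) := by
    intro m
    have hm : (0 : ℝ) ≤ m := Nat.cast_nonneg m
    set b : ℝ := R + m with hb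
    have hb3 : 3 ≤ b := by linarith
    have hb0 : 0 < b := by linarith
    have hI : volume (Icc (b + 1) (b + 2)) = 1 := by
      rw [Real.volume_Icc]; norm_num
    have hJ : volume (Ico b (b + 3)) = 3 := by
      rw [Real.volume_Ico]; norm_num
    have hIb : Icc (b + 1) (b + 2) ⊆ Icc b (4 * b) := Icc_subset_Icc (by linarith) (by linarith)
    have hJb : Ico b (b + 3) ⊆ Icc b (4 * b) := fun r hr => ⟨hr.1, by linarith [hr.2]⟩
    -- With shift `a = b - 1` the inner radius `a + 1` of the annulus is `b ≥ R`, so the weak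
    -- derivatives exist on all of it up to that sphere.
    have hloc := hC R (b - 1) (by linarith) (by linarith) u v hu hv hw
    rw [show b - 1 + 2 = b + 1 by ring, show b - 1 + 3 = b + 2 by ring,
      show b - 1 + 1 = b by ring, show b - 1 + 4 = b + 3 by ring] at hloc
    -- This identity is the reason for the exponent in the theorem: the frozen weights on the two
    -- sides coincide.
    have hexp : β + ((n : ℝ) - 1) * (q⁻¹).toReal = γ + ((n : ℝ) - 1) * (p⁻¹).toReal := by
      rw [hγ]; ring
    set w : ℝ≥0∞ := ENNReal.ofReal (b ^ (γ + ((n : ℝ) - 1) * (p⁻¹).toReal)) with hw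
    set M := eLpNorm (∑ μ ∈ yMultis n k, g μ) p ((powMeasure n).restrict (Ico b (b + 3))) with hM
    have hterm : ∀ μ ∈ yMultis n k,
        w * eLpNorm (v μ) s (cylMeasure n (Ico b (b + 3))) ≤ 3 * (B * M) := by
      intro μ hμ
      calc w * eLpNorm (v μ) s (cylMeasure n (Ico b (b + 3)))
          ≤ w * (3 * eLpNorm (sphereNorm s (v μ)) p (volume.restrict (Ico b (b + 3)))) :=
            mul_le_mul' le_rfl (eLpNorm_cylMeasure_le hs1 hst hsp (hv μ) hJ)
        _ = 3 * (w * eLpNorm (sphereNorm s (v μ)) p (volume.restrict (Ico b (b + 3)))) := by ring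
        _ ≤ 3 * (B * eLpNorm (g μ) p ((powMeasure n).restrict (Ico b (b + 3)))) :=
            mul_le_mul' le_rfl
              (mul_eLpNorm_le_eLpNorm_powMeasure hn p s γ (v μ) hb0 measurableSet_Ico hJb)
        _ ≤ 3 * (B * M) := by
            refine mul_le_mul' le_rfl (mul_le_mul' le_rfl (eLpNorm_mono_enorm fun r => ?_))
            rw [enorm_eq_self, enorm_eq_self, Finset.sum_apply]
            exact Finset.single_le_sum (f := fun μ => g μ r) (fun _ _ => zero_le) hμ
    calc eLpNorm (sphereNorm t (rWeight β u)) q ((powMeasure n).restrict (Icc (b + 1) (b + 2)))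
        ≤ A * (w * eLpNorm (sphereNorm t u) q (volume.restrict (Icc (b + 1) (b + 2)))) := by
          rw [hw, ← hexp]
          exact eLpNorm_powMeasure_le hn q t β u hb0 measurableSet_Icc hIb
      _ ≤ A * (w * (C * ∑ μ ∈ yMultis n k, eLpNorm (v μ) s (cylMeasure n (Ico b (b + 3))))) :=
          mul_le_mul' le_rfl (mul_le_mul' le_rfl ((eLpNorm_sphereNorm_le ht0 hqt hu hI).trans hloc))
      _ = A * (C * ∑ μ ∈ yMultis n k, w * eLpNorm (v μ) s (cylMeasure n (Ico b (b + 3)))) := by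
          rw [← Finset.mul_sum]; ring
      _ ≤ A * (C * ∑ μ ∈ yMultis n k, 3 * (B * M)) := by
          exact mul_le_mul' le_rfl (mul_le_mul' le_rfl (Finset.sum_le_sum hterm))
      _ = _ := by
          rw [Finset.sum_const, nsmul_eq_mul]
          push_cast
          ring
  refine (eLpNorm_Ici_le_of_intervals hp1 hpq key).trans ?_
  push_cast
  gcongr
  exact eLpNorm_sum_le (fun μ _ => (hgm μ).aestronglyMeasurable) hp1

/-- A local Sobolev inequality on the unit scale implies the weighted estimate on exteriors of
balls. -/
theorem sobolevEstimate_of_localSobolev (hn : 0 < n) {k : ℕ} {s t p q : ℝ≥0∞}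
    (hs1 : 1 ≤ s) (hst : s ≠ ⊤) (hsp : s ≤ p) (hpq : p ≤ q) (hqt : q ≤ t)
    (hS : LocalSobolev 𝕜 n k s t) (β : ℝ) : SobolevEstimate 𝕜 n k β p q t s := by
  obtain ⟨C, hC⟩ := exists_mixedNorm_le_of_stronglyMeasurable hn hs1 hst hsp hpq hqt hS β
  refine ⟨C, fun R hR u v h => ?_⟩
  have hR1 : 1 ≤ R := by linarith
  have hU : MeasurableSet {x : E | R < ‖x‖} := measurableSet_lt measurable_const measurable_norm
  have h0 : (0 : YMulti n) ∈ yMultis n k := by simp [mem_yMultis, yLen]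
  have hum := (h 0 h0).locallyIntegrableOn_left.aestronglyMeasurable
  have hvm : ∀ μ : YMulti n, ∃ w : E → 𝕜, StronglyMeasurable w ∧
      (μ ∈ yMultis n k → v μ =ᵐ[volume.restrict {x : E | R < ‖x‖}] w) := by
    intro μ
    by_cases hμ : μ ∈ yMultis n k
    · have hm := (h μ hμ).locallyIntegrableOn_right.aestronglyMeasurable
      exact ⟨hm.mk, hm.stronglyMeasurable_mk, fun _ => hm.ae_eq_mk⟩
    -- For `|μ| > k` nothing is assumed of `v μ`; it does not enter the estimate, and zero is a
    -- measurable stand-in.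
    · exact ⟨0, stronglyMeasurable_zero, fun h => absurd h hμ⟩
  choose w hw hvw using hvm
  have hmain := hC R hR hum.mk w hum.stronglyMeasurable_mk hw fun μ hμ =>
    (h μ hμ).congr hU hum.ae_eq_mk (hvw μ hμ)
  simp only [mixedNorm_eq] at hmain ⊢
  rw [eLpNorm_sphereNorm_congr hn hR1 (by linarith) hum.ae_eq_mk]
  refine hmain.trans (le_of_eq ?_)
  congr 1
  exact Finset.sum_congr rfl fun μ hμ =>
    (eLpNorm_sphereNorm_congr hn hR1 le_rfl (hvw μ hμ) p s _).symm

end Estimate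

end WeightedSobolev

end

/-! ### The three choices of exponents. -/

theorem lemma3p2 (𝕜 : Type*) [RCLike 𝕜] (n : ℕ) (hn : 2 ≤ n) :
    (∀ (β ε : ℝ) (p q : ℝ≥0∞), 0 < ε → ENNReal.ofReal (2 + ε) ≤ p → p ≤ q →
      WeightedSobolev.SobolevEstimate 𝕜 n ((n + 1) / 2) β p q ∞ (ENNReal.ofReal (2 + ε))) ∧
    (∀ (β : ℝ) (p q : ℝ≥0∞), 2 ≤ p → p ≤ q →
      WeightedSobolev.SobolevEstimate 𝕜 n ((n + 2) / 2) β p q ∞ 2) ∧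
    (∀ (β : ℝ) (p q : ℝ≥0∞), 2 ≤ p → p ≤ q → q ≤ 4 →
      WeightedSobolev.SobolevEstimate 𝕜 n ((n + 3) / 4) β p q 4 2) := by
  have hn0 : 0 < n := by omega
  refine ⟨fun β ε p q hε hp hpq => ?_, fun β p q hp hpq => ?_, fun β p q hp hpq hq => ?_⟩
  · refine WeightedSobolev.sobolevEstimate_of_localSobolev hn0 ?_ ENNReal.ofReal_ne_top hp hpq le_top
      (WeightedSobolev.localSobolev_top 𝕜 hn0 (by linarith) ?_) β
    · rw [← ENNReal.ofReal_one]
      exact ENNReal.ofReal_le_ofReal (by linarith)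
    -- With `k = [(n+1)/2]` only `n ≤ 2 k` holds; `ε > 0` makes `n < k (2 + ε)` strict.
    · have h1 : (n : ℝ) ≤ 2 * ((n + 1) / 2 : ℕ) := by
        exact_mod_cast (by omega : n ≤ 2 * ((n + 1) / 2))
      have h2 : (0 : ℝ) < ((n + 1) / 2 : ℕ) := by
        exact_mod_cast (by omega : 0 < (n + 1) / 2)
      nlinarith
  -- Without `ε` the strict inequality `n < 2 k` has to come from `k = [(n+2)/2]` itself.
  · have h := WeightedSobolev.localSobolev_top 𝕜 (k := (n + 2) / 2) hn0 (s := 2) (by norm_num) (by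
      exact_mod_cast (by omega : n < (n + 2) / 2 * 2))
    rw [ENNReal.ofReal_ofNat] at h
    exact WeightedSobolev.sobolevEstimate_of_localSobolev hn0 (by norm_num) (by norm_num) hp hpq
      le_top h β
  · exact WeightedSobolev.sobolevEstimate_of_localSobolev hn0 (by norm_num) (by norm_num) hp hpq hq
      (WeightedSobolev.localSobolev_four 𝕜 hn) β
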